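/- Let $p$ be a prime and $n\ge 2$ an integer, and let $\Sigma_p=\{0,1,\dots,p-1\}$. A necklace of length $m$ over $\Sigma_p$ is a class of words of length $m$ over $\Sigma_p$ up to cyclic rotation. The Burrows–Wheeler matrix of a necklace $[w]$ of length $m$ is the $m\times m$ matrix whose rows are the $m$ rotations of $w$ (with multiplicity) in ascending lexicographic order, and the Burrows–Wheeler transform of $[w]$ is the last column of this matrix. A necklace of length $pn$ over $\Sigma_p$ is called a generalized de Bruijn word if its Burrows–Wheeler transform is a concatenation of $n$ words of length $p$, each containing every letter of $\Sigma_p$ exactly once. A necklace over $\Sigma_p$ is called invertible if its Burrows–Wheeler matrix has nonzero determinant modulo $p$. Let $\mathrm{DBW}_p(pn)$ be the number of generalized de Bruijn words of length $pn$ over $\Sigma_p$, let $\mathrm{InvNeck}_p(n)$ be the number of invertible necklaces of length $n$ over $\Sigma_p$, and let $\Phi_p(n)$ be the number of polynomials over $\mathbb{F}_p$ of degree smaller than $n$ that are coprime with $X^n-1$ (the generalized Euler totient). Then \[ \mathrm{DBW}_p(pn)=\frac{((p-1)!)^n}{p-1}\cdot\frac{\Phi_p(n)}{n}=\frac{((p-1)!)^n}{p-1}\,\mathrm{InvNeck}_p(n),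 \] and in particular $\Phi_p(n)/n=\mathrm{InvNeck}_p(n)$. -/

import Mathlib

namespace BWNecklace

/-- Words of length `n` over the ordered alphabet `Σ_k = {0, 1, …, k-1}`. -/
abbrev Word (k n : ℕ) : Type := Fin n → Fin k

/-- The cyclic rotation `w_r w_{r+1} ⋯ w_{n-1} w_0 ⋯ w_{r-1}` of `w` (with `r` taken modulo `n`). -/
def rotate {k n : ℕ} (w : Word k n) (r : ℕ) : Word k n :=
  fun j => w ⟨((j : ℕ) + r) % n, Nat.mod_lt _ j.pos⟩

theorem rotate_zero {k n : ℕ} (w : Word k n) : rotate w 0 = w := by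
  funext j
  simp [rotate, Nat.mod_eq_of_lt j.isLt]

theorem rotate_rotate {k n : ℕ} (w : Word k n) (r s : ℕ) :
    rotate (rotate w r) s = rotate w (s + r) := by
  funext j
  simp [rotate, Nat.add_assoc]

theorem rotate_mod {k n : ℕ} (w : Word k n) (r : ℕ) : rotate w (r % n) = rotate w r := by
  funext j
  simp [rotate]

theorem rotate_self {k n : ℕ} (w : Word k n) : rotate w n = w := by
  rw [← rotate_mod, Nat.mod_self, rotate_zero]

/-- Two words of the same length are conjugate if one is a rotation of the other. -/
def conjugate (k n : ℕ) : Setoid (Word k n) where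
  r w w' := ∃ r : ℕ, w' = rotate w r
  iseqv :=
    { refl := fun w => ⟨0, (rotate_zero w).symm⟩
      symm := by
        rintro w _ ⟨r, rfl⟩
        refine ⟨n - r % n, ?_⟩
        rcases Nat.eq_zero_or_pos n with rfl | hn
        · funext j
          exact j.elim0
        · rw [← rotate_mod w r, rotate_rotate,
            Nat.sub_add_cancel (Nat.mod_lt r hn).le, rotate_self]
      trans := by
        rintro w _ _ ⟨r, rfl⟩ ⟨s, rfl⟩
        exact ⟨s + r, rotate_rotate w r s⟩ }

/-- Necklaces of length `n` over `Σ_k`: conjugacy classes of words. -/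
def Necklace (k n : ℕ) : Type := Quotient (conjugate k n)

/-- The `n` rotations of `w`, indexed by `0, …, n-1` and compared lexicographically. -/
def rotations {k n : ℕ} (w : Word k n) : Fin n → Lex (Word k n) :=
  fun i => toLex (rotate w i)

/-- The Burrows–Wheeler matrix of a word: its rows are the `n` rotations of the word
(counted with multiplicity) in ascending lexicographic order. -/
noncomputable def wordBWTMatrix {k n : ℕ} (w : Word k n) : Matrix (Fin n) (Fin n) (Fin k) :=
  Matrix.of fun i => ofLex (rotations w (Tuple.sort (rotations w) i))

theorem wordBWTMatrix_rotate {k n : ℕ} (w : Word k n) (r : ℕ) :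
    wordBWTMatrix (rotate w r) = wordBWTMatrix w := by
  have hinj : Function.Injective
      (fun i : Fin n => (⟨((i : ℕ) + r) % n, Nat.mod_lt _ i.pos⟩ : Fin n)) := by
    intro i j hij
    have h : ((i : ℕ) + r) ≡ ((j : ℕ) + r) [MOD n] := congrArg Fin.val hij
    have h2 : (i : ℕ) ≡ (j : ℕ) [MOD n] := Nat.ModEq.add_right_cancel' r h
    exact Fin.ext (Nat.ModEq.eq_of_lt_of_lt h2 i.isLt j.isLt)
  let ρ : Equiv.Perm (Fin n) := Equiv.ofBijective _ (Finite.injective_iff_bijective.mp hinj)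
  have h : rotations (rotate w r) = rotations w ∘ ρ := by
    funext i
    change toLex (rotate (rotate w r) i) = toLex (rotate w (((i : ℕ) + r) % n))
    rw [rotate_rotate, rotate_mod]
  have h2 : rotations (rotate w r) ∘ Tuple.sort (rotations (rotate w r)) =
      rotations w ∘ Tuple.sort (rotations w) := by
    rw [h]
    exact Tuple.comp_perm_comp_sort_eq_comp_sort
  exact congrArg (fun f : Fin n → Lex (Word k n) => Matrix.of fun i => ofLex (f i)) h2

/-- The Burrows–Wheeler matrix of a necklace. -/
noncomputable def Necklace.bwtMatrix {k n : ℕ} (x : Necklace k n) : Matrix (Fin n) (Fin n) (Fin k) :=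
  Quotient.lift (s := conjugate k n) wordBWTMatrix
    (by rintro w _ ⟨r, rfl⟩; exact (wordBWTMatrix_rotate w r).symm) x

/-- The Burrows–Wheeler transform of a necklace: the last column of its Burrows–Wheeler matrix. -/
noncomputable def Necklace.bwt {k n : ℕ} (x : Necklace k n) : Word k n :=
  fun i => x.bwtMatrix i ⟨n - 1, Nat.sub_lt i.pos Nat.one_pos⟩

theorem block_index_lt {k n : ℕ} (b : Fin n) (i : Fin k) : k * (b : ℕ) + (i : ℕ) < k * n :=
  calc k * (b : ℕ) + (i : ℕ) < k * (b : ℕ) + k := Nat.add_lt_add_left i.isLt _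
    _ = k * ((b : ℕ) + 1) := (Nat.mul_succ k b).symm
    _ ≤ k * n := Nat.mul_le_mul_left k b.isLt

/-- A word of length `k * n` over `Σ_k` is an alphabet-permutation power if each of its `n`
consecutive blocks of length `k` contains every letter of `Σ_k` exactly once. -/
def IsAlphabetPermutationPower {k n : ℕ} (u : Word k (k * n)) : Prop :=
  ∀ b : Fin n, ∀ a : Fin k, ∃! i : Fin k, u ⟨k * (b : ℕ) + (i : ℕ), block_index_lt b i⟩ = a

/-- Generalized de Bruijn words of length `k * n` over `Σ_k`. -/
def IsGeneralizedDeBruijn {k n : ℕ} (x : Necklace k (k * n)) : Prop :=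
  IsAlphabetPermutationPower x.bwt

/-- A necklace over `Σ_p` is invertible if its Burrows–Wheeler matrix has nonzero
determinant modulo `p`. -/
def IsInvertible {p n : ℕ} (x : Necklace p n) : Prop :=
  (x.bwtMatrix.map fun a : Fin p => ((a : ℕ) : ZMod p)).det ≠ 0

/-- The number of generalized de Bruijn words of length `k * n` over `Σ_k`. -/
noncomputable def DBW (k n : ℕ) : ℕ :=
  Nat.card {x : Necklace k (k * n) // IsGeneralizedDeBruijn x}

/-- The number of invertible necklaces of length `n` over `Σ_p`. -/
noncomputable def InvNeck (p n : ℕ) : ℕ :=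
  Nat.card {x : Necklace p n // IsInvertible x}

/-- The generalized Euler totient: the number of polynomials over `ZMod p` of degree smaller
than `n` that are coprime with `X ^ n - 1`. -/
noncomputable def Phi (p n : ℕ) : ℕ :=
  Nat.card {f : Polynomial (ZMod p) //
    f.degree < (n : WithBot ℕ) ∧ IsCoprime f (Polynomial.X ^ n - 1)}

end BWNecklace

/-! A word made of `n` permutations of the alphabet is the Burrows–Wheeler transform of a necklace
exactly when its standard permutation is a single cycle, and the necklace is then unique
(`wordBWT_inverseBWT`, `exists_rotate_eq_inverseBWT`). In such a word this permutation follows the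
edges `p w + i → w` of a digraph on ℤ/n, so `DBW p n` counts transition systems of that digraph with
one cycle, i.e. its Eulerian circuits (`DBW_eq_card_transition`).

These are counted by a determinantal form of the BEST theorem. If `M` is a permutation matrix with
one row cleared, `det (1 - M)` is 1 for a single cycle and 0 otherwise. In the sum over all
transition systems each block of rows may be replaced by its average, because the determinant is
alternating. This leaves `(p!)^n` times one determinant, which `det_average` turns into a Laplacian
with a rank-one correction. By `det_sub_funMatrix` that Laplacian determinant, multiplied by `(p -
1) n`, is `det (p - P)`, where `P` is the matrix of `x ↦ p x` on ℤ/n.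

On the other side, `|det (p - P)| = Phi p n` (`Phi_eq_natAbs_det`): for `p ∤ n`, a polynomial
coprime to `X^n - 1` amounts to a unit-valued function on ℤ/n with `h(x)^p = h(p x)`, that is, a
character of the cokernel of `p - P`; factors `p` of `n` are stripped off separately. Finally `Phi p
n = n * InvNeck p n`, since a Burrows–Wheeler matrix is a circulant up to transposition and the
order of its rows. -/

namespace BWNecklace
open Matrix

/-! ### Single-cycle transition systems and determinants. -/

theorem sum_perm_apply {D M : Type*} [Fintype D] [DecidableEq D] [Nonempty D]
    [AddCommGroup M] [Module ℚ M] (c : D → M) (i : D) :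
    ∑ ρ : Equiv.Perm D, c (ρ i) =
      ∑ _ρ : Equiv.Perm D, ((Fintype.card D : ℚ)⁻¹ • ∑ a, c a) := by
  have h1 : ∀ j : D, ∑ ρ : Equiv.Perm D, c (ρ j) = ∑ ρ : Equiv.Perm D, c (ρ i) := fun j =>
    Fintype.sum_equiv (Equiv.mulRight (Equiv.swap i j)) _ _ (fun ρ => by simp)
  have h2 : (Fintype.card D : ℚ) • ∑ ρ : Equiv.Perm D, c (ρ i) =
      ∑ _ρ : Equiv.Perm D, ∑ a, c a := by
    calc _ = ∑ j : D, ∑ ρ : Equiv.Perm D, c (ρ j) := by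
          rw [Finset.sum_congr rfl fun j _ => h1 j]
          simp [← Nat.cast_smul_eq_nsmul ℚ]
      _ = ∑ ρ : Equiv.Perm D, ∑ j : D, c (ρ j) := Finset.sum_comm
      _ = _ := Finset.sum_congr rfl fun ρ _ => Equiv.sum_comp ρ c
  have h0 : (Fintype.card D : ℚ) ≠ 0 := by simp
  rw [← Finset.smul_sum, ← h2, smul_smul, inv_mul_cancel₀ h0, one_smul]

/-- The rows of `B` in block `b` get a family of vectors, arranged by a permutation, added
to them, except for the row `e₀`. Summing the determinants over all permutations, the family may
be replaced by its average. -/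
theorem sum_perm_det_add_block {V D : Type*} [Fintype V] [DecidableEq V] [Fintype D]
    [DecidableEq D] [Nonempty D] (B : V × D → V × D → ℚ) (c : D → V × D → ℚ)
    (b : V) (e₀ : V × D) :
    ∑ ρ : Equiv.Perm D, det (Matrix.of fun e => B e +
        if e.1 = b ∧ e ≠ e₀ then c (ρ e.2) else 0) =
      ∑ _ρ : Equiv.Perm D, det (Matrix.of fun e => B e +
        if e.1 = b ∧ e ≠ e₀ then (Fintype.card D : ℚ)⁻¹ • ∑ a, c a else 0) := by
  -- Expand by multilinearity over the set `S` of rows that take the added vector. Only `S` inside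
  -- the block and avoiding `e₀` contributes.
  have key : ∀ N : V × D → V × D → ℚ, det (Matrix.of fun e => B e + N e) =
      ∑ S : Finset (V × D), det (Matrix.of fun e => if e ∈ S then N e else B e) := by
    intro N
    have h := (detRowAlternating (n := V × D) (R := ℚ)).toMultilinearMap.map_add_univ N B
    rw [add_comm N B] at h
    exact h
  simp only [key]
  rw [Finset.sum_comm, Finset.sum_comm (s := Finset.univ (α := Equiv.Perm D))]
  refine Finset.sum_congr rfl fun S _ => ?_
  by_cases hS : ∃ e ∈ S, ¬ (e.1 = b ∧ e ≠ e₀)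
  · obtain ⟨e, he, hne⟩ := hS
    rw [Finset.sum_eq_zero, Finset.sum_eq_zero] <;>
    · intro ρ _
      refine det_eq_zero_of_row_eq_zero e fun j => ?_
      simp only [of_apply, if_pos he, if_neg hne, Pi.zero_apply]
  push Not at hS
  have hgen : ∀ N : V × D → V × D → ℚ,
      (Matrix.of fun e => if e ∈ S then (if e.1 = b ∧ e ≠ e₀ then N e else 0) else B e) =
        Matrix.of fun e => if e ∈ S then N e else B e := by
    intro N
    ext e j
    by_cases he : e ∈ S
    · simp only [of_apply, if_pos he, if_pos (hS e he)]
    · simp only [of_apply, if_neg he]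
  simp only [hgen]
  -- With two rows in `S`, the averaged side has equal rows, and on the other side `ρ` and `ρ *
  -- swap` cancel. With at most one row, both sides agree by linearity.
  by_cases h2 : ∃ e ∈ S, ∃ e' ∈ S, e ≠ e'
  · obtain ⟨e, he, e', he', hne⟩ := h2
    have hright : det (Matrix.of fun e => if e ∈ S then (Fintype.card D : ℚ)⁻¹ • ∑ a, c a
        else B e) = 0 := by
      refine det_zero_of_row_eq hne ?_
      funext j
      simp only [of_apply, if_pos he, if_pos he']
    have hneg : ∀ ρ : Equiv.Perm D,
        det (Matrix.of fun f => if f ∈ S then c ((ρ * Equiv.swap e.2 e'.2) f.2) else B f) =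
        - det (Matrix.of fun f => if f ∈ S then c (ρ f.2) else B f) := by
      intro ρ
      have hp := det_permute (Equiv.swap e e') (Matrix.of fun f => if f ∈ S then c (ρ f.2) else B f)
      rw [Equiv.Perm.sign_swap hne] at hp
      simp only [Units.val_neg, Units.val_one, Int.cast_neg, Int.cast_one, neg_mul, one_mul] at hp
      rw [← hp]
      congr 1
      ext f j
      have h1 := (hS e he).1
      have h1' := (hS e' he').1
      simp only [of_apply, submatrix_apply, id]
      rcases eq_or_ne f e with rfl | hfe
      · simp [he, he']
      rcases eq_or_ne f e' with rfl | hfe'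
      · simp [he, he']
      rw [Equiv.swap_apply_of_ne_of_ne hfe hfe']
      split_ifs with hf
      · rw [Equiv.Perm.mul_apply, Equiv.swap_apply_of_ne_of_ne]
        · exact fun h => hfe (Prod.ext ((hS f hf).1.trans h1.symm) h)
        · exact fun h => hfe' (Prod.ext ((hS f hf).1.trans h1'.symm) h)
      · rfl
    simp only [hright, Finset.sum_const_zero]
    refine self_eq_neg.1 ?_
    rw [← Finset.sum_neg_distrib]
    simp only [← hneg]
    exact (Equiv.sum_comp (Equiv.mulRight (Equiv.swap e.2 e'.2)) fun ρ : Equiv.Perm D =>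
      det (Matrix.of fun f => if f ∈ S then c (ρ f.2) else B f)).symm
  · push Not at h2
    rcases S.eq_empty_or_nonempty with rfl | ⟨e, he⟩
    · simp
    · have hrow : ∀ N : V × D → V × D → ℚ, (Matrix.of fun e => if e ∈ S then N e else B e) =
          updateRow (Matrix.of B) e (N e) := by
        intro N
        ext f j
        rcases eq_or_ne f e with rfl | hf
        · simp [he]
        · have : f ∉ S := fun h => hf (h2 f h e he)
          rw [updateRow_ne hf]
          simp [this]
      simp only [hrow]
      have hsum : ∀ f : Equiv.Perm D → V × D → ℚ, ∑ ρ, det (updateRow (Matrix.of B) e (f ρ)) =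
          det (updateRow (Matrix.of B) e (∑ ρ, f ρ)) := fun f =>
        ((detRowAlternating (n := V × D) (R := ℚ)).toMultilinearMap.map_update_sum
          Finset.univ e f B).symm
      rw [hsum, hsum, sum_perm_apply c e.2]

theorem cut_mulVec {E : Type*} [Fintype E] [DecidableEq E] (σ : Equiv.Perm E) (e₀ : E)
    (v : E → ℚ) (e : E) :
    ((Matrix.of fun e f => if e ≠ e₀ ∧ f = σ e then (1 : ℚ) else 0) *ᵥ v) e =
      if e ≠ e₀ then v (σ e) else 0 := by
  simp only [mulVec, dotProduct, of_apply]
  by_cases he : e = e₀ <;> simp [he]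

/-- Every orbit runs into the cleared row `e₀`, so the matrix is nilpotent and its characteristic
polynomial `X ^ card E` takes the value 1 at 1. -/
theorem det_one_sub_cut_of_forall_sameCycle {E : Type*} [Fintype E] [DecidableEq E]
    (σ : Equiv.Perm E) (e₀ : E) (h : ∀ e, σ.SameCycle e e₀) :
    det (1 - Matrix.of fun e f => if e ≠ e₀ ∧ f = σ e then (1 : ℚ) else 0) = 1 := by
  set M : Matrix E E ℚ := Matrix.of fun e f => if e ≠ e₀ ∧ f = σ e then (1 : ℚ) else 0
  have hM := cut_mulVec σ e₀
  have hit : ∀ (k : ℕ) (v : E → ℚ) e, (∃ j < k, (σ ^ j) e = e₀) → ((M ^ k) *ᵥ v) e = 0 := by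
    intro k
    induction k with
    | zero => rintro v e ⟨j, hj, _⟩; omega
    | succ k ih =>
      rintro v e ⟨j, hj, hje⟩
      rw [pow_succ', ← mulVec_mulVec, hM]
      split_ifs with he
      · refine ih _ _ ⟨j - 1, ?_, ?_⟩
        · rcases j with _ | j
          · exact absurd hje he
          · omega
        · rcases j with _ | j
          · exact absurd hje he
          · simpa [pow_succ] using hje
      · rfl
  choose j hj using fun e => (h e).exists_nat_pow_eq
  have hnil : IsNilpotent M := by
    -- The sum of the hitting times bounds each of them.
    refine ⟨∑ e, j e + 1, ?_⟩
    refine Matrix.ext_of_mulVec_single fun f => ?_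
    funext e
    rw [hit _ _ e ⟨j e, ?_, hj e⟩]
    · simp
    · exact Nat.lt_succ_of_le (Finset.single_le_sum (f := j) (fun _ _ => Nat.zero_le _)
        (Finset.mem_univ e))
  have hc : M.charpoly = Polynomial.X ^ Fintype.card E := by
    have := isNilpotent_charpoly_sub_pow_of_isNilpotent hnil
    exact sub_eq_zero.1 this.eq_zero
  have := M.eval_charpoly 1
  rw [hc] at this
  simpa using this.symm

/-- The indicator of the complement of the cycle of `e₀` is a nonzero kernel vector. -/
theorem det_one_sub_cut_of_not_sameCycle {E : Type*} [Fintype E] [DecidableEq E]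
    (σ : Equiv.Perm E) (e₀ e₁ : E) (h : ¬ σ.SameCycle e₁ e₀) :
    det (1 - Matrix.of fun e f => if e ≠ e₀ ∧ f = σ e then (1 : ℚ) else 0) = 0 := by
  classical
  refine Matrix.exists_mulVec_eq_zero_iff.1
    ⟨fun e => if σ.SameCycle e e₀ then 0 else 1, fun h0 => ?_, ?_⟩
  · simpa [h] using congrFun h0 e₁
  · funext e
    rw [sub_mulVec, one_mulVec, Pi.sub_apply, cut_mulVec]
    by_cases he : e = e₀
    · simp [he, Equiv.Perm.SameCycle.refl]
    · simp [he, Equiv.Perm.sameCycle_apply_left]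

/-- The edge permutation of a transition system: `θ (v, a)` is the edge leaving the vertex `v` at
its port `a`, and the permutation `π v` joins the entries of `v` to its ports. -/
def transition {V D : Type*} (θ : Equiv.Perm (V × D)) (π : V → Equiv.Perm D) :
    Equiv.Perm (V × D) :=
  (Equiv.prodShear (Equiv.refl V) π).trans θ

theorem transition_apply {V D : Type*} (θ : Equiv.Perm (V × D)) (π : V → Equiv.Perm D)
    (e : V × D) : transition θ π e = θ (e.1, π e.1 e.2) := rfl

/-- The permutations at different vertices are independent, so the blocks can be averaged one vertex
at a time; in `G T` those of `T` are already averaged. -/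
theorem sum_det_transition {V D : Type*} [Fintype V] [DecidableEq V] [Fintype D]
    [DecidableEq D] [Nonempty D] (θ : Equiv.Perm (V × D)) (e₀ : V × D) :
    ∑ π : V → Equiv.Perm D, det (1 - Matrix.of fun e f =>
        if e ≠ e₀ ∧ f = transition θ π e then (1 : ℚ) else 0) =
      ∑ _π : V → Equiv.Perm D, det (1 - Matrix.of fun e f =>
        if e ≠ e₀ ∧ (θ.symm f).1 = e.1 then (Fintype.card D : ℚ)⁻¹ else 0) := by
  let c : V → D → V × D → ℚ := fun v a => -Pi.single (θ (v, a)) 1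
  let G : Finset V → (V → Equiv.Perm D) → ℚ := fun T π => det (Matrix.of fun e =>
    (1 : Matrix (V × D) (V × D) ℚ) e + if e ≠ e₀ then
      (if e.1 ∈ T then (Fintype.card D : ℚ)⁻¹ • ∑ a, c e.1 a else c e.1 (π e.1 e.2)) else 0)
  have step : ∀ T : Finset V, ∑ π, G T π = ∑ π, G ∅ π := by
    intro T
    induction T using Finset.induction_on with
    | empty => rfl
    | insert b T hb ih =>
      rw [← ih]
      -- Changing `π` at `b` alone by `ρ` reindexes the sum over `π`, and the sum over `ρ` averages
      -- block `b`.
      have h1 : ∀ π, ∑ ρ : Equiv.Perm D, G T (π * Pi.mulSingle (M := fun _ => Equiv.Perm D) b ρ) =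
          ∑ _ρ : Equiv.Perm D, G (insert b T) π := by
        intro π
        have h := sum_perm_det_add_block (fun e => (1 : Matrix (V × D) (V × D) ℚ) e +
          if e ≠ e₀ ∧ e.1 ≠ b then (if e.1 ∈ T then (Fintype.card D : ℚ)⁻¹ • ∑ a, c e.1 a
            else c e.1 (π e.1 e.2)) else 0) (fun a => c b (π b a)) b e₀
        rw [Equiv.sum_comp (π b) (c b)] at h
        refine (Finset.sum_congr rfl fun ρ _ => congrArg det ?_).trans
          (h.trans (Finset.sum_congr rfl fun ρ _ => congrArg det ?_))
        · ext e f
          by_cases he : e = e₀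
          · simp [he]
          by_cases heb : e.1 = b
          · simp [he, heb, hb]
          · simp [he, heb]
        · ext e f
          by_cases he : e = e₀
          · simp [he]
          by_cases heb : e.1 = b
          · simp [he, heb]
          · simp [he, heb]
      have h2 : (Fintype.card (Equiv.Perm D) : ℚ) * ∑ π, G T π =
          (Fintype.card (Equiv.Perm D) : ℚ) * ∑ π, G (insert b T) π := by
        calc _ = ∑ ρ : Equiv.Perm D, ∑ π, G T (π * Pi.mulSingle (M := fun _ => Equiv.Perm D) b ρ) := by
              have h3 : ∀ ρ : Equiv.Perm D, ∑ π, G T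
                  (π * Pi.mulSingle (M := fun _ => Equiv.Perm D) b ρ) = ∑ π, G T π := fun ρ =>
                Equiv.sum_comp (Equiv.mulRight
                  (Pi.mulSingle (M := fun _ => Equiv.Perm D) b ρ)) (G T)
              simp only [h3, Finset.sum_const, nsmul_eq_mul, Finset.card_univ]
          _ = ∑ π, ∑ ρ : Equiv.Perm D, G T (π * Pi.mulSingle (M := fun _ => Equiv.Perm D) b ρ) := by rw [Finset.sum_comm]
          _ = _ := by
              simp only [h1, Finset.sum_const, nsmul_eq_mul, Finset.mul_sum, Finset.card_univ]
      have h0 : (Fintype.card (Equiv.Perm D) : ℚ) ≠ 0 := Nat.cast_ne_zero.2 Fintype.card_ne_zero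
      exact ((mul_right_inj' h0).1 h2).symm
  refine Eq.trans (Finset.sum_congr rfl fun π _ => congrArg det ?_) ((step Finset.univ).symm.trans
    (Finset.sum_congr rfl fun π _ => congrArg det ?_))
  · ext e f
    by_cases he : e = e₀
    · simp [he]
    · simp [he, c, transition_apply, Pi.single_apply, sub_eq_add_neg]
  · ext e f
    by_cases he : e = e₀
    · simp [he]
    · have : ∑ a, (Pi.single (θ (e.1, a)) (1 : ℚ) : V × D → ℚ) f =
          if (θ.symm f).1 = e.1 then 1 else 0 := by
        simp only [Pi.single_apply, ← Equiv.symm_apply_eq, Prod.ext_iff]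
        by_cases hf : (θ.symm f).1 = e.1 <;> simp [hf]
      simp [he, c, Finset.sum_apply, this, sub_eq_add_neg]

/-- The number of transition systems whose edge permutation is a single cycle. -/
theorem card_transition_cycle {V D : Type*} [Fintype V] [DecidableEq V] [Fintype D]
    [DecidableEq D] [Nonempty D] (θ : Equiv.Perm (V × D)) (e₀ : V × D) :
    (Nat.card {π : V → Equiv.Perm D // ∀ e, (transition θ π).SameCycle e e₀} : ℚ) =
      ((Fintype.card D).factorial : ℚ) ^ Fintype.card V *
        det (1 - Matrix.of fun e f =>
          if e ≠ e₀ ∧ (θ.symm f).1 = e.1 then (Fintype.card D : ℚ)⁻¹ else 0) := by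
  classical
  have h := sum_det_transition θ e₀
  have h1 : ∀ π : V → Equiv.Perm D, det (1 - Matrix.of fun e f =>
        if e ≠ e₀ ∧ f = transition θ π e then (1 : ℚ) else 0) =
      if ∀ e, (transition θ π).SameCycle e e₀ then 1 else 0 := by
    intro π
    split_ifs with hc
    · exact det_one_sub_cut_of_forall_sameCycle _ _ hc
    · push Not at hc
      obtain ⟨e₁, he₁⟩ := hc
      exact det_one_sub_cut_of_not_sameCycle _ _ _ he₁
  simp only [h1] at h
  rw [Nat.card_eq_fintype_card, Fintype.card_subtype, ← Finset.sum_boole, h]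
  simp [Fintype.card_perm]

/-- The average determinant is a determinant indexed by the vertices. -/
theorem det_average {V D : Type*} [Fintype V] [DecidableEq V] [Fintype D]
    [DecidableEq D] [Nonempty D] (θ : Equiv.Perm (V × D)) (e₀ : V × D) :
    (Fintype.card D : ℚ) ^ Fintype.card V * det (1 - Matrix.of fun e f : V × D =>
          if e ≠ e₀ ∧ (θ.symm f).1 = e.1 then (Fintype.card D : ℚ)⁻¹ else 0) =
      det ((Fintype.card D : ℚ) • (1 : Matrix V V ℚ) -
        (Matrix.of fun v w => ((Finset.univ.filter fun i : D => (θ.symm (w, i)).1 = v).card : ℚ)) +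
        vecMulVec (Pi.single (θ.symm e₀).1 1) (Pi.single e₀.1 1)) := by
  have h0 : (Fintype.card D : ℚ) ≠ 0 := by simp
  -- The averaged matrix factors through `V`, so `det (1 - U W) = det (1 - W U)` passes to vertices.
  -- The cleared row `e₀` becomes the rank-one term.
  let U : Matrix (V × D) V ℚ := Matrix.of fun e v => if e ≠ e₀ ∧ e.1 = v then 1 else 0
  let W : Matrix V (V × D) ℚ := Matrix.of fun v f =>
    if (θ.symm f).1 = v then (Fintype.card D : ℚ)⁻¹ else 0
  have hUW : (Matrix.of fun e f : V × D =>
      if e ≠ e₀ ∧ (θ.symm f).1 = e.1 then (Fintype.card D : ℚ)⁻¹ else 0) = U * W := by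
    ext e f
    simp only [U, W, mul_apply, of_apply, ite_mul, one_mul, zero_mul]
    by_cases he : e = e₀ <;> simp [he]
  rw [hUW, det_one_sub_mul_comm, ← det_smul]
  congr 1
  ext v w
  have : (W * U) v w = ∑ i : D, (if (θ.symm (w, i)).1 = v then (Fintype.card D : ℚ)⁻¹ else 0) -
      (if (θ.symm e₀).1 = v ∧ e₀.1 = w then (Fintype.card D : ℚ)⁻¹ else 0) := by
    simp only [U, W, mul_apply, of_apply, mul_ite, mul_one, mul_zero]
    have hterm : ∀ f : V × D, (if f ≠ e₀ ∧ f.1 = w then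
          if (θ.symm f).1 = v then (Fintype.card D : ℚ)⁻¹ else 0 else 0) =
        (if f.1 = w then if (θ.symm f).1 = v then (Fintype.card D : ℚ)⁻¹ else 0 else 0) -
        if f = e₀ then if (θ.symm e₀).1 = v ∧ e₀.1 = w then (Fintype.card D : ℚ)⁻¹ else 0
          else 0 := by
      intro f
      by_cases hf : f = e₀
      · subst hf
        by_cases h1 : f.1 = w <;> by_cases h2 : (θ.symm f).1 = v <;> simp [h1, h2]
      · simp [hf]
    rw [Finset.sum_congr rfl fun f _ => hterm f, Finset.sum_sub_distrib, Fintype.sum_prod_type,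
      Finset.sum_comm]
    simp
  simp only [Matrix.smul_apply, Matrix.sub_apply, this, Matrix.add_apply, of_apply, vecMulVec_apply, Pi.single_apply,
    smul_eq_mul, mul_sub, ← Finset.sum_boole, Finset.mul_sum, mul_ite, mul_zero,
    mul_inv_cancel₀ h0]
  simp only [eq_comm (a := v), eq_comm (a := w)]
  by_cases h1 : (θ.symm e₀).1 = v <;> by_cases h2 : e₀.1 = w <;> simp [h1, h2, sub_add]

end BWNecklace

namespace BWNecklace
open Matrix

/-! ### From the Laplacian to the matrix of multiplication by `p`. -/

theorem det_add_vecMulVec_right {V : Type*} [Fintype V] [DecidableEq V] [Nonempty V]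
    (L : Matrix V V ℚ) (hL : L *ᵥ 1 = 0) (x y : V → ℚ) :
    det (L + vecMulVec x y) * Fintype.card V = (∑ v, y v) * det (L + vecMulVec x 1) := by
  have h0 : (Fintype.card V : ℚ) ≠ 0 := Nat.cast_ne_zero.2 Fintype.card_ne_zero
  -- Chosen so that `y = 1 + card V • u`; since `L` kills `1`, the factor `1 + vecMulVec 1 u` then
  -- turns `vecMulVec x 1` into `vecMulVec x y` and leaves `L` alone.
  set u : V → ℚ := (Fintype.card V : ℚ)⁻¹ • (y - 1)
  have h : L + vecMulVec x y = (L + vecMulVec x 1) * (1 + vecMulVec 1 u) := by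
    have hu : y = 1 + (Fintype.card V : ℚ) • u := by
      simp only [u, smul_smul, mul_inv_cancel₀ h0, one_smul]
      abel
    have h1 : (1 : V → ℚ) ⬝ᵥ 1 = Fintype.card V := by simp [dotProduct]
    rw [mul_add, mul_one, add_mul, mul_vecMulVec, hL, vecMulVec_mul_vecMulVec, h1]
    conv_lhs => rw [hu]
    simp [vecMulVec_add, vecMulVec_smul, add_assoc]
  have hdet : det (1 + vecMulVec (1 : V → ℚ) u) * Fintype.card V = ∑ v, y v := by
    rw [vecMulVec_eq Unit, det_one_add_replicateCol_mul_replicateRow]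
    simp only [dotProduct, u]
    simp only [Pi.smul_apply, Pi.sub_apply, Pi.one_apply, mul_one, smul_eq_mul, ← Finset.mul_sum,
      Finset.sum_sub_distrib, Finset.sum_const, Finset.card_univ, nsmul_eq_mul]
    field_simp
    ring
  rw [h, det_mul, mul_assoc, hdet, mul_comm]

/-- Only the sums of `x` and `y` matter; this lets one rank-one correction be traded for another. -/
theorem det_add_vecMulVec {V : Type*} [Fintype V] [DecidableEq V] [Nonempty V]
    (L : Matrix V V ℚ) (hL : L *ᵥ 1 = 0) (hL' : 1 ᵥ* L = 0) (x y : V → ℚ) :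
    det (L + vecMulVec x y) * Fintype.card V ^ 2 =
      (∑ v, x v) * (∑ v, y v) * det (L + vecMulVec 1 1) := by
  have h1 := det_add_vecMulVec_right L hL x y
  have h2 := det_add_vecMulVec_right Lᵀ (by rw [mulVec_transpose, hL']) 1 x
  rw [← det_transpose, ← det_transpose (Lᵀ + _), transpose_add, transpose_add, transpose_transpose,
    transpose_vecMulVec, transpose_vecMulVec] at h2
  linear_combination (Fintype.card V : ℚ) * h1 + (∑ v, y v) * h2

/-- The matrix of the linear extension of a self-map of a finite set. -/
def funMatrix {V : Type*} [DecidableEq V] (R : Type*) [Zero R] [One R] (g : V → V) :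
    Matrix V V R :=
  Matrix.of fun u w => if u = g w then 1 else 0

section funMatrix
variable {V : Type*} [Fintype V] [DecidableEq V] {R : Type*} [CommRing R]

theorem vecMul_funMatrix (g : V → V) (v : V → R) (w : V) : (v ᵥ* funMatrix R g) w = v (g w) := by
  simp [vecMul, dotProduct, funMatrix]

theorem funMatrix_mul (g h : V → V) : funMatrix R g * funMatrix R h = funMatrix R (g ∘ h) := by
  ext u w
  simp [mul_apply, funMatrix]

end funMatrix

theorem funMatrix_id {V R : Type*} [DecidableEq V] [CommRing R] :
    funMatrix R (id : V → V) = 1 := by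
  ext u w
  simp [funMatrix, one_apply]

/-- The Laplacian of the digraph with the edges `f 0 w → w, …, f (p - 1) w → w`, where
`f` runs through the images of `f 0` under a cyclic shift `s`, compared with the matrix of
`f 0`. -/
theorem det_sub_funMatrix {V : Type*} [Fintype V] [DecidableEq V] [Nonempty V] {p : ℕ}
    (s : Equiv.Perm V) (hs : ∀ v w, s.SameCycle v w) (θ : Equiv.Perm (V × Fin p))
    (f : ℕ → V → V) (hf : ∀ i w, f (i + 1) w = s (f i w)) (hfp : ∀ w, f p w = f 0 (s w))
    (hθ : ∀ w i, (θ.symm (w, i)).1 = f i w) (x y : V) :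
    det ((p : ℚ) • (1 : Matrix V V ℚ) - funMatrix ℚ (f 0)) =
      ((p : ℚ) - 1) * Fintype.card V * det ((p : ℚ) • (1 : Matrix V V ℚ) -
        (Matrix.of fun v w =>
          ((Finset.univ.filter fun i : Fin p => (θ.symm (w, i)).1 = v).card : ℚ)) +
        vecMulVec (Pi.single x 1) (Pi.single y 1)) := by
  have h0 : (Fintype.card V : ℚ) ≠ 0 := Nat.cast_ne_zero.2 Fintype.card_ne_zero
  set A : Matrix V V ℚ := Matrix.of fun v w =>
    ((Finset.univ.filter fun i : Fin p => (θ.symm (w, i)).1 = v).card : ℚ) with hA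
  set L : Matrix V V ℚ := (p : ℚ) • (1 : Matrix V V ℚ) - A with hLdef
  set P : Matrix V V ℚ := funMatrix ℚ (f 0)
  have hAsum : A = ∑ i ∈ Finset.range p, funMatrix ℚ (f i) := by
    rw [Finset.sum_range]
    ext v w
    simp [hA, hθ, funMatrix, Matrix.sum_apply, eq_comm]
  have hrow : A *ᵥ 1 = (p : ℚ) • 1 := by
    funext v
    have : ∑ w : V, ∑ i : Fin p, (if (θ.symm (w, i)).1 = v then (1 : ℚ) else 0) = p := by
      rw [← Fintype.sum_prod_type' (f := fun w i => if (θ.symm (w, i)).1 = v then (1 : ℚ) else 0),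
        Equiv.sum_comp θ.symm fun e : V × Fin p => if e.1 = v then (1 : ℚ) else 0,
        Fintype.sum_prod_type, Finset.sum_comm]
      simp
    simpa [hA, mulVec, dotProduct] using this
  have hcol : 1 ᵥ* A = (p : ℚ) • 1 := by
    funext w
    rw [hAsum, vecMul_sum]
    simp [vecMul_funMatrix]
  have hL : L *ᵥ 1 = 0 := by
    rw [hLdef, sub_mulVec, hrow, smul_mulVec, one_mulVec, sub_self]
  have hL' : 1 ᵥ* L = 0 := by
    rw [hLdef, vecMul_sub, hcol, vecMul_smul, vecMul_one, sub_self]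
  set D : Matrix V V ℚ := funMatrix ℚ s - 1 with hD
  set J : Matrix V V ℚ := vecMulVec 1 1 with hJ
  -- Composing with `s` sends `f i` to `f (i + 1)`, so the product telescopes to `f p` minus `f 0`,
  -- and `f p = f 0 ∘ s`.
  have hDA : D * A = P * D := by
    have htel : funMatrix ℚ s * A - A = funMatrix ℚ (f p) - funMatrix ℚ (f 0) := by
      rw [hAsum, Finset.mul_sum, ← Finset.sum_sub_distrib,
        ← Finset.sum_range_sub fun i => funMatrix ℚ (f i)]
      refine Finset.sum_congr rfl fun i _ => ?_
      rw [funMatrix_mul]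
      congr 2
      funext w
      exact (hf i w).symm
    rw [hD, sub_mul, one_mul, htel, mul_sub, mul_one, funMatrix_mul]
    congr 2
    funext w
    exact hfp w
  -- As `s` is a single cycle, only constants are left-annihilated by `D`, and `J` removes those.
  have hDJ : det (D + J) ≠ 0 := by
    intro h
    obtain ⟨v, hv, hv0⟩ := exists_vecMul_eq_zero_iff.2 h
    have h1 : ∀ w, v (s w) - v w + ∑ u, v u = 0 := by
      intro w
      have := congrFun hv0 w
      rw [vecMul_add, hJ, vecMul_vecMulVec] at this
      simpa [hD, vecMul_sub, vecMul_funMatrix, dotProduct] using this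
    have h2 : ∑ u, v u = 0 := by
      have h3 : ∑ w, (v (s w) - v w + ∑ u, v u) = 0 := Finset.sum_eq_zero fun w _ => h1 w
      rw [Finset.sum_add_distrib, Finset.sum_sub_distrib, Equiv.sum_comp s v, sub_self, zero_add,
        Finset.sum_const, nsmul_eq_mul, Finset.card_univ] at h3
      exact (mul_eq_zero.1 h3).resolve_left h0
    have h3 : ∀ w, v (s w) = v w := fun w => by
      have := h1 w
      rw [h2] at this
      linarith
    have h4 : ∀ k : ℕ, ∀ w, v ((s ^ k) w) = v w := by
      intro k
      induction k with
      | zero => simp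
      | succ k ih => intro w; rw [pow_succ', Equiv.Perm.mul_apply, h3, ih]
    apply hv
    funext w
    have h5 : ∀ u, v u = v w := fun u => by
      obtain ⟨k, hk⟩ := (hs w u).exists_nat_pow_eq
      rw [← hk, h4]
    rw [Finset.sum_congr rfl fun u _ => h5 u, Finset.sum_const, nsmul_eq_mul,
      Finset.card_univ] at h2
    exact (mul_eq_zero.1 h2).resolve_left h0
  have hunit : IsUnit (det (D + J)) := hDJ.isUnit
  -- `D` intertwines `p - P` with `L` but is singular. With `D + J` in its place, `z` absorbs the
  -- rank-one error; its coordinate sum is the source of the factor `p - 1`.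
  set z : V → ℚ := (D + J)⁻¹ *ᵥ ((p : ℚ) • 1 - P *ᵥ 1) with hz
  have hz1 : (D + J) *ᵥ z = (p : ℚ) • 1 - P *ᵥ 1 := by
    rw [hz, mulVec_mulVec, mul_nonsing_inv _ hunit, one_mulVec]
  have hJD : 1 ᵥ* D = 0 := by
    funext w
    simp [hD, vecMul_sub, vecMul_funMatrix]
  have hJL : J * L = 0 := by rw [hJ, vecMulVec_mul, hL', vecMulVec_zero]
  have hzsum : ∑ v, z v = p - 1 := by
    have h1 := congrArg (fun w => (1 : V → ℚ) ⬝ᵥ w) hz1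
    have h2 : (1 : V → ℚ) ᵥ* P = 1 := by
      funext w
      simp [P, vecMul_funMatrix]
    simp only [dotProduct_mulVec, vecMul_add, hJD, zero_add, hJ, vecMul_vecMulVec, dotProduct_sub,
      dotProduct_smul, h2] at h1
    have h3 : (1 : V → ℚ) ⬝ᵥ 1 = Fintype.card V := by simp [dotProduct]
    rw [h3, smul_dotProduct, one_dotProduct, smul_eq_mul, smul_eq_mul] at h1
    refine mul_left_cancel₀ h0 (h1.trans ?_)
    ring
  have hconj : ((p : ℚ) • (1 : Matrix V V ℚ) - P) * (D + J) =
      (D + J) * (L + vecMulVec z 1) := by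
    have hPJ : P * J = vecMulVec (P *ᵥ 1) 1 := by rw [hJ, mul_vecMulVec]
    rw [mul_add (D + J), mul_vecMulVec, hz1, add_mul D J L, hJL, add_zero, hLdef, mul_sub D, hDA,
      sub_mul, mul_add P, hPJ, sub_vecMulVec, smul_vecMulVec]
    simp only [smul_mul_assoc, one_mul, mul_smul_comm, mul_one, smul_add, ← hJ]
    abel
  have hdet : det ((p : ℚ) • (1 : Matrix V V ℚ) - P) = det (L + vecMulVec z 1) := by
    have := congrArg det hconj
    rw [det_mul, det_mul, mul_comm] at this
    exact mul_left_cancel₀ hDJ this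
  have e1 := det_add_vecMulVec L hL hL' z 1
  have e2 := det_add_vecMulVec L hL hL' (Pi.single x 1) (Pi.single y 1)
  simp only [hzsum, Finset.sum_pi_single', Finset.mem_univ, if_true, Pi.one_apply,
    Finset.sum_const, Finset.card_univ, nsmul_eq_mul, mul_one, one_mul] at e1 e2
  rw [hdet]
  refine mul_right_cancel₀ (pow_ne_zero 2 h0) ?_
  rw [e1, ← e2]
  ring

end BWNecklace

namespace BWNecklace
open Matrix

/-! ### Characters of the cokernel of `p - P`. -/

/-- Modulo `p` only minus a permutation matrix remains. Hence the cokernel has order prime to `p`.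
-/
theorem det_smul_one_sub_funMatrix_not_dvd {S : Type*} [Fintype S] [DecidableEq S] {p : ℕ}
    (hp : p.Prime) (g : Equiv.Perm S) :
    ¬ (p : ℤ) ∣ det ((p : ℤ) • (1 : Matrix S S ℤ) - funMatrix ℤ g) := by
  have := Fact.mk hp
  rw [← ZMod.intCast_zmod_eq_zero_iff_dvd, ← eq_intCast (Int.castRingHom (ZMod p)),
    RingHom.map_det]
  have h : (Int.castRingHom (ZMod p)).mapMatrix ((p : ℤ) • (1 : Matrix S S ℤ) - funMatrix ℤ g) =
      - funMatrix (ZMod p) g := by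
    ext u w
    simp only [RingHom.mapMatrix_apply, map_apply, Matrix.sub_apply, Matrix.smul_apply,
      Matrix.neg_apply, funMatrix, of_apply, smul_eq_mul, map_sub, map_mul, map_natCast,
      CharP.cast_eq_zero, zero_mul, zero_sub]
    split_ifs <;> simp
  rw [h, det_neg]
  have hu : det (funMatrix (ZMod p) g) * det (funMatrix (ZMod p) g.symm) = 1 := by
    rw [← det_mul, funMatrix_mul, Equiv.self_comp_symm, funMatrix_id, det_one]
  exact mul_ne_zero (pow_ne_zero _ (by simp)) (left_ne_zero_of_mul_eq_one hu)

theorem card_quotient_range_mulVecLin {S : Type*} [Fintype S] [DecidableEq S]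
    (M : Matrix S S ℤ) (hM : det M ≠ 0) :
    Nat.card ((S → ℤ) ⧸ LinearMap.range M.mulVecLin) = (det M).natAbs := by
  have hinj : Function.Injective M.mulVecLin := mulVec_injective_of_det_ne_zero hM
  rw [← Submodule.natAbs_det_equiv _ (LinearEquiv.ofInjective M.mulVecLin hinj),
    ← LinearMap.det_toLin' M]
  rfl

/-- The condition on `h` says that it factors through the group with generators `x` and relations `p
x = g x`, which is the cokernel `Q`. Its order is prime to the characteristic, so it has as many
characters into `Kˣ` as elements. -/
theorem card_units_pow_eq {S : Type*} [Fintype S] [DecidableEq S] {p : ℕ} (hp : p.Prime)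
    (g : Equiv.Perm S) (K : Type*) [Field K] [IsAlgClosed K] [CharP K p] :
    Nat.card {h : S → Kˣ // ∀ x, h x ^ p = h (g x)} =
      (det ((p : ℤ) • (1 : Matrix S S ℤ) - funMatrix ℤ g)).natAbs := by
  set M : Matrix S S ℤ := (p : ℤ) • (1 : Matrix S S ℤ) - funMatrix ℤ g with hM
  have hnd := det_smul_one_sub_funMatrix_not_dvd hp g
  have hdet : det M ≠ 0 := fun h => hnd (h ▸ dvd_zero _)
  have hcol : ∀ x, M *ᵥ Pi.single x 1 = (p : ℤ) • Pi.single x 1 - Pi.single (g x) 1 := by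
    intro x
    rw [hM, sub_mulVec, smul_mulVec, one_mulVec]
    congr 1
    ext u
    simp [funMatrix, Pi.single_apply]
  let Q := (S → ℤ) ⧸ LinearMap.range M.mulVecLin
  have hcard : Nat.card (Multiplicative Q) = (det M).natAbs :=
    card_quotient_range_mulVecLin M hdet
  have hpos : 0 < Nat.card (Multiplicative Q) := by
    rw [hcard]; exact Int.natAbs_pos.2 hdet
  have : Finite (Multiplicative Q) := (Nat.card_pos_iff.1 hpos).2
  have hne : NeZero ((Monoid.exponent (Multiplicative Q) : ℕ) : K) := by
    refine ⟨fun h => hnd ?_⟩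
    rw [CharP.cast_eq_zero_iff K p] at h
    exact Int.natCast_dvd.2 (hcard ▸ h.trans Group.exponent_dvd_nat_card)
  rw [← hcard, ← CommGroup.card_monoidHom_of_hasEnoughRootsOfUnity (Multiplicative Q) K]
  symm
  let gen : S → Q := fun x => Submodule.Quotient.mk (Pi.single x 1)
  have hgen : ∀ x, p • gen x = gen (g x) := by
    intro x
    have : gen (g x) = Submodule.Quotient.mk ((p : ℤ) • Pi.single x (1 : ℤ)) := by
      refine ((Submodule.Quotient.eq _).2 ?_).symm
      exact ⟨Pi.single x 1, hcol x⟩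
    rw [this, Submodule.Quotient.mk_smul, natCast_zsmul]
  refine Nat.card_congr (Equiv.ofBijective (fun φ => ⟨fun x => φ (.ofAdd (gen x)), fun x => ?_⟩)
    ⟨fun φ ψ h => ?_, fun ⟨h, hh⟩ => ?_⟩)
  · rw [← map_pow, ← ofAdd_nsmul, hgen]
  · have h1 : ∀ x, φ (.ofAdd (gen x)) = ψ (.ofAdd (gen x)) :=
      fun x => congrFun (congrArg Subtype.val h) x
    have h2 : (MonoidHom.toAdditiveRight φ).toIntLinearMap ∘ₗ (LinearMap.range M.mulVecLin).mkQ =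
        (MonoidHom.toAdditiveRight ψ).toIntLinearMap ∘ₗ (LinearMap.range M.mulVecLin).mkQ := by
      refine (Pi.basisFun ℤ S).ext fun x => ?_
      rw [Pi.basisFun_apply]
      exact h1 x
    ext q
    obtain ⟨v, hv⟩ :=
      Submodule.Quotient.mk_surjective (LinearMap.range M.mulVecLin) (Multiplicative.toAdd q)
    have := LinearMap.congr_fun h2 v
    change φ (.ofAdd (Submodule.Quotient.mk v)) = ψ (.ofAdd (Submodule.Quotient.mk v)) at this
    rw [hv] at this
    exact congrArg Units.val this
  · let F : (S → ℤ) →ₗ[ℤ] Additive Kˣ :=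
      (Pi.basisFun ℤ S).constr ℤ fun x => Additive.ofMul (h x)
    have hF : ∀ x, F (Pi.single x 1) = Additive.ofMul (h x) := fun x => by
      have := (Pi.basisFun ℤ S).constr_basis ℤ (fun x => Additive.ofMul (h x)) x
      rwa [Pi.basisFun_apply] at this
    have hle : LinearMap.range M.mulVecLin ≤ LinearMap.ker F := by
      rw [LinearMap.range_le_ker_iff]
      refine (Pi.basisFun ℤ S).ext fun x => ?_
      simp only [LinearMap.comp_apply, Pi.basisFun_apply, mulVecLin_apply, hcol, map_sub, map_smul,
        hF, LinearMap.zero_apply]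
      rw [← hh, sub_eq_zero, natCast_zsmul, ofMul_pow]
    refine ⟨AddMonoidHom.toMultiplicativeLeft
      ((LinearMap.range M.mulVecLin).liftQ F hle).toAddMonoidHom, ?_⟩
    refine Subtype.ext (funext fun x => ?_)
    exact hF x

end BWNecklace

namespace BWNecklace
open Matrix

/-! ### The totient as a determinant. -/

/-- Multiplication by `p` on the residues modulo `n`. -/
def mulMod (p n : ℕ) (x : Fin n) : Fin n := ⟨p * x % n, Nat.mod_lt _ x.pos⟩

theorem mulMod_injective {p n : ℕ} (h : p.Coprime n) : Function.Injective (mulMod p n) := by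
  intro x y hxy
  have h1 : p * (x : ℕ) ≡ p * (y : ℕ) [MOD n] := congrArg Fin.val hxy
  have h2 : (x : ℕ) ≡ (y : ℕ) [MOD n] :=
    Nat.ModEq.cancel_left_of_coprime (by rwa [Nat.gcd_comm]) h1
  exact Fin.ext (Nat.ModEq.eq_of_lt_of_lt h2 x.isLt y.isLt)

theorem smul_one_sub_funMatrix_apply {V R : Type*} [DecidableEq V] [CommRing R] (c : R)
    (g : V → V) (u w : V) : (c • (1 : Matrix V V R) - funMatrix R g) u w =
      (if u = w then c else 0) - if u = g w then 1 else 0 := by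
  rw [Matrix.sub_apply, Matrix.smul_apply, one_apply, smul_eq_mul, mul_ite, mul_one, mul_zero]
  rfl

/-- The multiples of `p` among the residues modulo `p * m`. -/
def multiplesEquiv {p : ℕ} (hp : 0 < p) (m : ℕ) : Fin m ≃ {x : Fin (p * m) // p ∣ (x : ℕ)} where
  toFun y := ⟨⟨p * (y : ℕ), Nat.mul_lt_mul_of_pos_left y.isLt hp⟩, dvd_mul_right _ _⟩
  invFun x := ⟨(x.1 : ℕ) / p, Nat.div_lt_of_lt_mul x.1.isLt⟩
  left_inv _ := Fin.ext (Nat.mul_div_cancel_left _ hp)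
  right_inv x := Subtype.ext (Fin.ext (Nat.mul_div_cancel' x.2))

/-- Multiplication by `p` lands in the multiples of `p`, so the matrix is block triangular: the
block of non-multiples is scalar, and that of multiples is the matrix for `m`. -/
theorem det_smul_one_sub_mulMod_mul {p : ℕ} (hp : 0 < p) (m : ℕ) :
    det ((p : ℤ) • (1 : Matrix (Fin (p * m)) (Fin (p * m)) ℤ) - funMatrix ℤ (mulMod p (p * m))) =
      (p : ℤ) ^ (p * m - m) *
        det ((p : ℤ) • (1 : Matrix (Fin m) (Fin m) ℤ) - funMatrix ℤ (mulMod p m)) := by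
  have hdvd : ∀ w : Fin (p * m), p ∣ (mulMod p (p * m) w : ℕ) := fun w =>
    (Nat.dvd_mod_iff (dvd_mul_right p m)).2 (dvd_mul_right p _)
  have hne : ∀ u w : Fin (p * m), ¬ p ∣ (u : ℕ) → u ≠ mulMod p (p * m) w :=
    fun u w hu h => hu (h ▸ hdvd w)
  rw [twoBlockTriangular_det _ (fun x : Fin (p * m) => p ∣ (x : ℕ)), mul_comm]
  · congr 1
    · have : toSquareBlockProp ((p : ℤ) • (1 : Matrix (Fin (p * m)) (Fin (p * m)) ℤ) -
          funMatrix ℤ (mulMod p (p * m))) (fun x : Fin (p * m) => ¬ p ∣ (x : ℕ)) =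
          (p : ℤ) • 1 := by
        ext u w
        rw [toSquareBlockProp, toBlock_apply, smul_one_sub_funMatrix_apply, if_neg (hne u.1 w.1 u.2),
          sub_zero, Matrix.smul_apply, one_apply]
        simp only [Subtype.ext_iff, smul_eq_mul, mul_ite, mul_one, mul_zero]
      rw [this, det_smul, det_one, mul_one, Fintype.card_subtype_compl,
        ← Fintype.card_congr (multiplesEquiv hp m), Fintype.card_fin, Fintype.card_fin]
    · rw [← det_submatrix_equiv_self (multiplesEquiv hp m)]
      congr 1
      ext u w
      have h1 : ((multiplesEquiv hp m u : Fin (p * m)) = mulMod p (p * m) (multiplesEquiv hp m w)) ↔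
          u = mulMod p m w := by
        simp only [Fin.ext_iff, mulMod, multiplesEquiv, Equiv.coe_fn_mk, Nat.mul_mod_mul_left]
        exact ⟨fun h => Nat.eq_of_mul_eq_mul_left hp h, fun h => by rw [h]⟩
      have h2 : ((multiplesEquiv hp m u : Fin (p * m)) = (multiplesEquiv hp m w : Fin (p * m))) ↔
          u = w := by rw [← Subtype.ext_iff, EmbeddingLike.apply_eq_iff_eq]
      rw [submatrix_apply, toSquareBlockProp, toBlock_apply, smul_one_sub_funMatrix_apply,
        smul_one_sub_funMatrix_apply]
      simp only [h1, h2]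
  · intro u hu w hw
    have : u ≠ w := fun h => hu (h ▸ hw)
    rw [smul_one_sub_funMatrix_apply, if_neg this, if_neg (hne u w hu), sub_zero]

open Polynomial

theorem card_degree_lt (p : ℕ) [Fact p.Prime] (k : ℕ) :
    Nat.card {q : (ZMod p)[X] // q.degree < (k : WithBot ℕ)} = p ^ k := by
  have e : {q : (ZMod p)[X] // q.degree < (k : WithBot ℕ)} ≃ (Fin k → ZMod p) :=
    (Equiv.subtypeEquivRight fun q => mem_degreeLT.symm).trans (degreeLTEquiv (ZMod p) k).toEquiv
  rw [Nat.card_congr e, Nat.card_fun, Nat.card_zmod, Nat.card_eq_fintype_card, Fintype.card_fin]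

/-- Divide by `g`: coprimality depends only on the remainder, and the quotient is free. -/
theorem card_coprime_degree_lt (p : ℕ) [Fact p.Prime] (g : (ZMod p)[X]) (hg : g.Monic) (k : ℕ) :
    Nat.card {f : (ZMod p)[X] // f.degree < ((g.natDegree + k : ℕ) : WithBot ℕ) ∧ IsCoprime f g} =
      p ^ k * Nat.card {f : (ZMod p)[X] // f.degree < (g.natDegree : WithBot ℕ) ∧
        IsCoprime f g} := by
  have hdeg : g.degree = g.natDegree := degree_eq_natDegree hg.ne_zero
  rw [← card_degree_lt, ← Nat.card_prod]
  symm
  refine Nat.card_congr (Equiv.ofBijective (fun x => ⟨x.2.1 + g * x.1.1, ?_, ?_⟩)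
    ⟨fun x y h => ?_, fun ⟨f, hf, hc⟩ => ?_⟩)
  · refine (degree_add_le _ _).trans_lt (max_lt (x.2.2.1.trans_le ?_) ?_)
    · exact_mod_cast Nat.le_add_right _ _
    · by_cases h0 : x.1.1 = 0
      · rw [h0, mul_zero, degree_zero]; exact WithBot.bot_lt_coe _
      · have := x.1.2
        rw [degree_mul, hdeg, degree_eq_natDegree h0] at *
        norm_cast at this ⊢
        omega
  · exact IsCoprime.add_mul_left_left x.2.2.2 _
  · have h1 := congrArg Subtype.val h
    have hx := div_modByMonic_unique x.1.1 x.2.1 hg ⟨rfl, x.2.2.1.trans_eq hdeg.symm⟩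
    have hy := div_modByMonic_unique y.1.1 y.2.1 hg ⟨rfl, y.2.2.1.trans_eq hdeg.symm⟩
    simp only at h1
    rw [h1] at hx
    exact Prod.ext (Subtype.ext (hx.1.symm.trans hy.1)) (Subtype.ext (hx.2.symm.trans hy.2))
  · have hsplit : f = f %ₘ g + g * (f /ₘ g) := (modByMonic_add_div f g).symm
    refine ⟨⟨⟨f /ₘ g, ?_⟩, ⟨f %ₘ g, hdeg ▸ degree_modByMonic_lt f hg, ?_⟩⟩, Subtype.ext hsplit.symm⟩
    · by_cases h0 : f /ₘ g = 0
      · rw [h0, degree_zero]; exact WithBot.bot_lt_coe _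
      · rw [degree_eq_natDegree h0]
        have hf0 : f ≠ 0 := by rintro rfl; simp at h0
        rw [degree_eq_natDegree hf0] at hf
        have hle : g.natDegree ≤ f.natDegree := by
          by_contra hlt
          push Not at hlt
          exact h0 ((divByMonic_eq_zero_iff hg).2 (degree_lt_degree hlt))
        rw [natDegree_divByMonic f hg]
        norm_cast at hf ⊢
        omega
    · rw [hsplit] at hc
      exact IsCoprime.of_add_mul_left_left hc

theorem Phi_mul (p : ℕ) (hp : p.Prime) (m : ℕ) (hm : m ≠ 0) :
    Phi p (p * m) = p ^ (p * m - m) * Phi p m := by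
  have := Fact.mk hp
  have hg : (X ^ m - 1 : (ZMod p)[X]).Monic := monic_X_pow_sub_C 1 hm
  have hdeg : (X ^ m - 1 : (ZMod p)[X]).natDegree = m := natDegree_X_pow_sub_C (n := m) (r := 1)
  have h := card_coprime_degree_lt p _ hg (p * m - m)
  rw [hdeg, Nat.add_sub_cancel' (Nat.le_mul_of_pos_left m hp.pos)] at h
  rw [Phi, Phi, ← h]
  refine Nat.card_congr (Equiv.subtypeEquivRight fun f => and_congr_right fun _ => ?_)
  have : (X ^ (p * m) - 1 : (ZMod p)[X]) = (X ^ m - 1) ^ p := by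
    rw [sub_pow_char, one_pow, ← pow_mul, mul_comm]
  rw [this, IsCoprime.pow_right_iff hp.pos]

/-- A polynomial of degree below `n` is its values at the `n`-th roots of unity. Coprimality makes
them nonzero, and coefficients in the prime field amount to Frobenius compatibility. -/
theorem Phi_eq_card_units_pow_eq {p n : ℕ} (hp : p.Prime) (hpn : p.Coprime n)
    (K : Type) [Field K] [IsAlgClosed K] [Algebra (ZMod p) K] :
    Phi p n = Nat.card {h : Fin n → Kˣ // ∀ x, h x ^ p = h (mulMod p n x)} := by
  have := Fact.mk hp
  have hchar : CharP K p := charP_of_injective_algebraMap (algebraMap (ZMod p) K).injective p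
  have hn : NeZero (n : K) := ⟨fun h => by
    rw [CharP.cast_eq_zero_iff K p] at h
    exact (hp.coprime_iff_not_dvd.1 hpn) h⟩
  obtain ⟨ζ, hζ⟩ := HasEnoughRootsOfUnity.exists_primitiveRoot K n
  have hn0 : n ≠ 0 := fun h => hn.out (by rw [h, Nat.cast_zero])
  have : NeZero n := ⟨hn0⟩
  have hinj : Set.InjOn (fun x : Fin n => ζ ^ (x : ℕ)) (Finset.univ : Finset (Fin n)) :=
    fun x _ y _ hxy => Fin.ext (hζ.pow_inj x.isLt y.isLt hxy)
  have hmul : ∀ x : Fin n, ζ ^ (mulMod p n x : ℕ) = (ζ ^ (x : ℕ)) ^ p := by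
    intro x
    rw [← pow_mul, mul_comm (x : ℕ), ← pow_mod_orderOf ζ (p * x), ← hζ.eq_orderOf]
    rfl
  have hfrob : ∀ (f : (ZMod p)[X]) (a : K), aeval (a ^ p) f = aeval a f ^ p := by
    intro f a
    rw [← expand_aeval, ZMod.expand_card, map_pow]
  have hcop : ∀ f : (ZMod p)[X], IsCoprime f (X ^ n - 1) ↔
      ∀ x : Fin n, aeval (ζ ^ (x : ℕ)) f ≠ 0 := by
    intro f
    constructor
    · rintro ⟨a, b, hab⟩ x hx
      have := congrArg (aeval (ζ ^ (x : ℕ))) hab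
      simp [hx, ← pow_mul, mul_comm, hζ.pow_eq_one, pow_mul ζ n] at this
    · intro h
      refine (isCoprime_iff_aeval_ne_zero_of_isAlgClosed (k := ZMod p) K f _).2 fun a => ?_
      by_cases ha : a ^ n = 1
      · obtain ⟨i, hi, rfl⟩ := hζ.eq_pow_of_pow_eq_one ha
        exact Or.inl (h ⟨i, hi⟩)
      · right
        simpa [sub_eq_zero] using ha
  refine Nat.card_congr (Equiv.ofBijective (fun f => ⟨fun x => Units.mk0 _ ((hcop f.1).1 f.2.2 x),
    fun x => Units.ext ?_⟩) ⟨fun f g h => ?_, fun ⟨h, hh⟩ => ?_⟩)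
  · simp [hmul, hfrob]
  · have h1 : ∀ x : Fin n, aeval (ζ ^ (x : ℕ)) f.1 = aeval (ζ ^ (x : ℕ)) g.1 := fun x =>
      congrArg Units.val (congrFun (congrArg Subtype.val h) x)
    refine Subtype.ext (map_injective (algebraMap (ZMod p) K) (algebraMap (ZMod p) K).injective ?_)
    refine Polynomial.eq_of_degrees_lt_of_eval_index_eq Finset.univ hinj ?_ ?_ fun x _ => ?_
    · simpa using f.2.1
    · simpa using g.2.1
    · simpa using h1 x
  · set F : K[X] := Lagrange.interpolate Finset.univ (fun x : Fin n => ζ ^ (x : ℕ))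
      (fun x => (h x : K)) with hF
    have hFdeg : F.degree < (n : WithBot ℕ) := by
      have := Lagrange.degree_interpolate_lt (fun x => (h x : K)) hinj
      rwa [Finset.card_univ, Fintype.card_fin] at this
    have hFev : ∀ x : Fin n, F.eval (ζ ^ (x : ℕ)) = h x := fun x =>
      Lagrange.eval_interpolate_at_node (fun x => (h x : K)) hinj (Finset.mem_univ x)
    -- Both sides agree at all nodes, since `p` is invertible modulo `n` and every node is a `p`-th
    -- power of a node.
    have hFF : F.map (frobenius K p) = F := by
      refine Polynomial.eq_of_degrees_lt_of_eval_index_eq Finset.univ hinj ?_ ?_ fun x _ => ?_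
      · simpa using hFdeg
      · simpa using hFdeg
      · obtain ⟨y, rfl⟩ := (Finite.injective_iff_surjective.1 (mulMod_injective hpn)) x
        rw [hFev, ← hh, hmul, ← frobenius_def, eval_map, eval₂_at_apply, hFev, frobenius_def,
          Units.val_pow_eq_pow_val]
    have hlift : F ∈ lifts (algebraMap (ZMod p) K) := by
      rw [lifts_iff_coeff_lifts]
      intro i
      have h1 : F.coeff i ^ p = F.coeff i := by
        conv_rhs => rw [← hFF]
        rw [coeff_map, frobenius_def]
      have h2 := (Subfield.mem_bot_iff_pow_eq_self K p).2 h1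
      rw [Subfield.bot_eq_of_zMod_algebra p] at h2
      exact h2
    obtain ⟨f, hf⟩ := (mem_lifts F).1 hlift
    have hfev : ∀ x : Fin n, aeval (ζ ^ (x : ℕ)) f = h x := fun x => by
      rw [← hFev, ← hf, eval_map_algebraMap]
    refine ⟨⟨f, ?_, (hcop f).2 fun x => ?_⟩, ?_⟩
    · rwa [← hf, degree_map] at hFdeg
    · rw [hfev]; exact (h x).ne_zero
    · exact Subtype.ext (funext fun x => Units.ext (hfev x))

theorem Phi_eq_natAbs_det {p n : ℕ} (hp : p.Prime) (hn : n ≠ 0) :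
    Phi p n = (det ((p : ℤ) • (1 : Matrix (Fin n) (Fin n) ℤ) - funMatrix ℤ (mulMod p n))).natAbs := by
  have := Fact.mk hp
  induction n using Nat.strong_induction_on with
  | _ n ih =>
    by_cases hpn : p ∣ n
    · obtain ⟨m, rfl⟩ := hpn
      have hm : m ≠ 0 := by rintro rfl; simp at hn
      rw [Phi_mul p hp m hm, det_smul_one_sub_mulMod_mul hp.pos, Int.natAbs_mul, Int.natAbs_pow,
        Int.natAbs_natCast, ← ih m _ hm]
      exact lt_mul_of_one_lt_left (Nat.pos_of_ne_zero hm) hp.one_lt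
    · have hc : p.Coprime n := (Nat.Prime.coprime_iff_not_dvd hp).2 hpn
      have : CharP (AlgebraicClosure (ZMod p)) p :=
        charP_of_injective_algebraMap (algebraMap (ZMod p) _).injective p
      have := card_units_pow_eq hp (Equiv.ofBijective _
        (Finite.injective_iff_bijective.1 (mulMod_injective hc))) (AlgebraicClosure (ZMod p))
      rw [Phi_eq_card_units_pow_eq hp hc (AlgebraicClosure (ZMod p))]
      exact this

end BWNecklace

namespace BWNecklace
open Matrix Polynomial

/-! ### Circulants and invertible necklaces. -/

section shift
variable {n : ℕ} [NeZero n]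

theorem funMatrix_iterate {V R : Type*} [Fintype V] [DecidableEq V] [CommRing R] (g : V → V)
    (k : ℕ) : funMatrix R g ^ k = funMatrix R g^[k] := by
  induction k with
  | zero => rw [pow_zero, Function.iterate_zero, funMatrix_id]
  | succ k ih => rw [pow_succ, ih, funMatrix_mul, Function.iterate_succ]

theorem funMatrix_add_one_pow (R : Type*) [CommRing R] (k : ℕ) :
    funMatrix R (fun x : Fin n => x + 1) ^ k =
      funMatrix R (fun x : Fin n => x + Fin.ofNat n k) := by
  rw [funMatrix_iterate]
  congr 1
  induction k with
  | zero => funext x; simp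
  | succ k ih =>
    rw [Function.iterate_succ', ih]
    funext x
    rw [Function.comp_apply, add_assoc]
    congr 1
    ext
    simp [Fin.val_add]

theorem aeval_funMatrix_add_one {R : Type*} [CommRing R] (f : R[X]) (hf : f.degree < (n : WithBot ℕ)) :
    aeval (funMatrix R (fun x : Fin n => x + 1)) f = circulant fun i : Fin n => f.coeff i := by
  have hsum : f = ∑ i : Fin n, C (f.coeff i) * X ^ (i : ℕ) := by
    rw [Fin.sum_univ_eq_sum_range fun i => C (f.coeff i) * X ^ i]
    refine f.as_sum_range_C_mul_X_pow' ?_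
    rcases eq_or_ne f 0 with rfl | h0
    · simpa using Nat.pos_of_ne_zero (NeZero.ne n)
    · exact (natDegree_lt_iff_degree_lt h0).2 hf
  conv_lhs => rw [hsum]
  ext u v
  simp only [map_sum, map_mul, aeval_C, map_pow, aeval_X, funMatrix_add_one_pow,
    Algebra.algebraMap_eq_smul_one, smul_mul_assoc, one_mul, Matrix.sum_apply, Matrix.smul_apply,
    circulant_apply]
  simp only [funMatrix, of_apply, Fin.ofNat_val_eq_self, smul_eq_mul, mul_ite, mul_one, mul_zero,
    ← sub_eq_iff_eq_add']
  simp

/-- The circulant is `f(Z)` for the cyclic shift `Z`, whose annihilator is generated by `X ^ n - 1`.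
-/
theorem det_circulant_ne_zero_iff {F : Type*} [Field F] (f : F[X]) (hf : f.degree < (n : WithBot ℕ)) :
    det (circulant fun i : Fin n => f.coeff i) ≠ 0 ↔ IsCoprime f (X ^ n - 1) := by
  classical
  set Z := funMatrix F (fun x : Fin n => x + 1)
  have hn := NeZero.ne n
  have hmon : (X ^ n - 1 : F[X]).Monic := monic_X_pow_sub_C 1 hn
  have hZ : aeval Z (X ^ n - 1 : F[X]) = 0 := by
    rw [map_sub, map_pow, aeval_X, map_one, funMatrix_add_one_pow, sub_eq_zero, ← funMatrix_id]
    congr 1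
    funext x
    simp
  have hdvd : ∀ g : F[X], aeval Z g = 0 → X ^ n - 1 ∣ g := by
    intro g hg
    rw [← modByMonic_eq_zero_iff_dvd hmon]
    have hdeg : (g %ₘ (X ^ n - 1)).degree < (n : WithBot ℕ) := by
      have := degree_modByMonic_lt g hmon
      rwa [← C_1, degree_X_pow_sub_C (Nat.pos_of_ne_zero hn)] at this
    have hr : aeval Z (g %ₘ (X ^ n - 1)) = 0 := by
      have := congrArg (aeval Z) (modByMonic_add_div g (X ^ n - 1))
      rwa [map_add, map_mul, hZ, zero_mul, add_zero, hg] at this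
    rw [aeval_funMatrix_add_one _ hdeg] at hr
    ext i
    by_cases hi : i < n
    · have := congrFun (congrFun hr ⟨i, hi⟩) 0
      simpa using this
    · rw [coeff_eq_zero_of_degree_lt, coeff_zero]
      exact hdeg.trans_le (by exact_mod_cast not_lt.1 hi)
  rw [← aeval_funMatrix_add_one f hf, ← isUnit_iff_ne_zero, ← isUnit_iff_isUnit_det]
  constructor
  · intro hu
    obtain ⟨k, hk⟩ := EuclideanDomain.gcd_dvd_left f (X ^ n - 1)
    obtain ⟨h, hh⟩ := EuclideanDomain.gcd_dvd_right f (X ^ n - 1)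
    rw [← EuclideanDomain.gcd_isUnit_iff]
    set d := EuclideanDomain.gcd f (X ^ n - 1)
    have h0 : h ≠ 0 := by
      rintro rfl
      exact hmon.ne_zero (by rw [hh, mul_zero])
    -- The cofactor `h` of the gcd `d` is killed by the unit `f(Z)`, so `X ^ n - 1 = d * h` divides
    -- `h` and `d` is a unit.
    have hfh : aeval Z f * aeval Z h = 0 := by
      rw [← map_mul, hk, mul_right_comm, ← hh, map_mul, hZ, zero_mul]
    have h1 : aeval Z h = 0 := (hu.mul_right_eq_zero).1 hfh
    obtain ⟨c, hc⟩ := hdvd h h1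
    rw [hh] at hc
    refine IsUnit.of_mul_eq_one c ?_
    refine mul_left_cancel₀ h0 ?_
    rw [mul_one]
    conv_rhs => rw [hc]
    ring
  · rintro ⟨a, b, hab⟩
    have := congrArg (aeval Z) hab
    rw [map_add, map_mul, map_mul, hZ, mul_zero, add_zero, map_one] at this
    exact IsUnit.of_mul_eq_one_right _ this

end shift

theorem isInvertible_mk_iff {p n : ℕ} (w : Word p n) :
    IsInvertible (Quotient.mk (conjugate p n) w) ↔
      det (Matrix.of fun i j : Fin n => ((rotate w i j : ℕ) : ZMod p)) ≠ 0 := by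
  have h : (wordBWTMatrix w).map (fun a : Fin p => ((a : ℕ) : ZMod p)) =
      (Matrix.of fun i j : Fin n => ((rotate w i j : ℕ) : ZMod p)).submatrix
        (Tuple.sort (rotations w)) id := rfl
  change det ((wordBWTMatrix w).map _) ≠ 0 ↔ _
  rw [h, det_permute]
  rcases Int.units_eq_one_or (Equiv.Perm.sign (Tuple.sort (rotations w))) with hs | hs <;> simp [hs]

theorem det_rotate_ne_zero_iff {p n : ℕ} [NeZero n] (w : Word p n) :
    det (Matrix.of fun i j : Fin n => ((rotate w i j : ℕ) : ZMod p)) ≠ 0 ↔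
      det (circulant fun i : Fin n => ((w i : ℕ) : ZMod p)) ≠ 0 := by
  have h : (Matrix.of fun i j : Fin n => ((rotate w i j : ℕ) : ZMod p)) =
      ((circulant fun i : Fin n => ((w i : ℕ) : ZMod p))ᵀ).submatrix (Equiv.neg (Fin n)) id := by
    ext i j
    simp only [of_apply, submatrix_apply, transpose_apply, circulant_apply, Equiv.neg_apply,
      sub_neg_eq_add, id]
    rfl
  rw [h, det_permute, det_transpose]
  rcases Int.units_eq_one_or (Equiv.Perm.sign (Equiv.neg (Fin n))) with hs | hs <;> simp [hs]

theorem rotate_injective_of_isInvertible {p n : ℕ} {w : Word p n}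
    (hw : IsInvertible (Quotient.mk (conjugate p n) w)) {r s : Fin n}
    (h : rotate w r = rotate w s) : r = s := by
  by_contra hne
  refine (isInvertible_mk_iff w).1 hw (det_zero_of_row_eq hne ?_)
  funext j
  simp only [of_apply, h]

/-- Equal rotations would give equal rows, so an invertible necklace consists of `n` distinct words.
-/
theorem card_isInvertible_words {p n : ℕ} (hn : n ≠ 0) :
    Nat.card {w : Word p n // IsInvertible (Quotient.mk (conjugate p n) w)} =
      InvNeck p n * n := by
  have : NeZero n := ⟨hn⟩
  have hout : ∀ x : Necklace p n, Quotient.mk (conjugate p n) (Quotient.out x) = x :=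
    fun x => Quotient.out_eq x
  have hmk : ∀ (w : Word p n) (r : ℕ), Quotient.mk (conjugate p n) (rotate w r) =
      Quotient.mk (conjugate p n) w :=
    fun w r => (Quotient.sound (⟨r, rfl⟩ : (conjugate p n).r w (rotate w r))).symm
  have hprod : InvNeck p n * n = Nat.card ({x : Necklace p n // IsInvertible x} × Fin n) := by
    rw [Nat.card_prod, Nat.card_fin, InvNeck]
  rw [hprod]
  symm
  refine Nat.card_congr (Equiv.ofBijective (fun x => ⟨rotate (Quotient.out x.1.1) x.2, ?_⟩)
    ⟨fun x y h => ?_, fun ⟨w, hw⟩ => ?_⟩)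
  · rw [hmk, hout]; exact x.1.2
  · have h1 := congrArg Subtype.val h
    simp only at h1
    have h2 : x.1 = y.1 := by
      have := congrArg (Quotient.mk (conjugate p n)) h1
      rw [hmk, hmk, hout, hout] at this
      exact Subtype.ext this
    rw [h2] at h1
    refine Prod.ext h2 (rotate_injective_of_isInvertible ?_ h1)
    rw [hout]; exact y.1.2
  · obtain ⟨r, hr⟩ := Quotient.exact (hout (Quotient.mk (conjugate p n) w))
    refine ⟨(⟨Quotient.mk (conjugate p n) w, hw⟩, ⟨r % n, Nat.mod_lt _ (Nat.pos_of_ne_zero hn)⟩),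
      Subtype.ext ?_⟩
    exact (rotate_mod _ r).trans hr.symm

theorem Phi_eq_InvNeck_mul {p n : ℕ} (hp : p.Prime) (hn : n ≠ 0) : Phi p n = InvNeck p n * n := by
  have := Fact.mk hp
  have : NeZero n := ⟨hn⟩
  rw [← card_isInvertible_words hn, Phi]
  have hcast : ∀ a : ZMod p, ((a.val : ℕ) : ZMod p) = a := ZMod.natCast_zmod_val
  refine Nat.card_congr (Equiv.ofBijective (fun f =>
    ⟨fun i => ⟨(f.1.coeff i).val, ZMod.val_lt _⟩, ?_⟩) ⟨fun f g h => ?_, fun ⟨w, hw⟩ => ?_⟩)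
  · rw [isInvertible_mk_iff, det_rotate_ne_zero_iff]
    simp only [hcast]
    exact (det_circulant_ne_zero_iff f.1 f.2.1).2 f.2.2
  · have h1 := congrArg Subtype.val h
    refine Subtype.ext (Polynomial.ext fun i => ?_)
    by_cases hi : i < n
    · have h2 := congrArg Fin.val (congrFun h1 ⟨i, hi⟩)
      exact ZMod.val_injective p h2
    · have hle : (n : WithBot ℕ) ≤ i := by exact_mod_cast not_lt.1 hi
      rw [coeff_eq_zero_of_degree_lt (f.2.1.trans_le hle),
        coeff_eq_zero_of_degree_lt (g.2.1.trans_le hle)]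
  · rw [isInvertible_mk_iff, det_rotate_ne_zero_iff] at hw
    let f : (ZMod p)[X] := ((degreeLTEquiv (ZMod p) n).symm fun i => ((w i : ℕ) : ZMod p) : _)
    have hdeg : f.degree < (n : WithBot ℕ) := mem_degreeLT.1 (Subtype.prop _)
    have hcoeff : ∀ i : Fin n, f.coeff i = ((w i : ℕ) : ZMod p) := fun i =>
      congrFun ((degreeLTEquiv (ZMod p) n).apply_symm_apply fun i => ((w i : ℕ) : ZMod p)) i
    refine ⟨⟨f, hdeg, (det_circulant_ne_zero_iff f hdeg).1 ?_⟩, Subtype.ext (funext fun i =>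
      Fin.ext ?_)⟩
    · simpa only [hcoeff] using hw
    · simp only [hcoeff]
      exact ZMod.val_cast_of_lt (w i).isLt

end BWNecklace

namespace BWNecklace

/-! ### Inverting the Burrows–Wheeler transform. -/

/-- `g` is the standard permutation of the word `u`: it ranks the positions of `u` by their
letters, equal letters from left to right. -/
def IsStandardPerm {k N : ℕ} (u : Word k N) (g : Equiv.Perm (Fin N)) : Prop :=
  ∀ x y, u x < u y ∨ (u x = u y ∧ x < y) → g x < g y

theorem IsStandardPerm.lt_or_of_lt {k N : ℕ} {u : Word k N} {g : Equiv.Perm (Fin N)}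
    (hg : IsStandardPerm u g) {x y : Fin N} (h : g x < g y) : u x < u y ∨ (u x = u y ∧ x < y) := by
  by_contra hxy
  rcases eq_or_ne x y with rfl | hne
  · exact lt_irrefl _ h
  · refine lt_asymm h (hg y x ?_)
    push Not at hxy
    rcases hxy.1.lt_or_eq with h1 | h1
    · exact Or.inl h1
    · exact Or.inr ⟨h1, lt_of_le_of_ne (hxy.2 h1.symm) hne.symm⟩

theorem IsStandardPerm.unique {k N : ℕ} {u : Word k N} {g g' : Equiv.Perm (Fin N)}
    (hg : IsStandardPerm u g) (hg' : IsStandardPerm u g') : g' = g := by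
  have hmono : Monotone (g' * g⁻¹) := by
    refine StrictMono.monotone fun a b hab => hg' _ _ (hg.lt_or_of_lt ?_)
    simpa using hab
  exact mul_inv_eq_one.1 ((Equiv.Perm.monotone_iff _).1 hmono)

/-- The last column of the Burrows–Wheeler matrix of a word. -/
noncomputable def wordBWT {k N : ℕ} (w : Word k N) : Word k N :=
  fun i => wordBWTMatrix w i ⟨N - 1, Nat.sub_lt i.pos Nat.one_pos⟩

/-- The word read off along a permutation of the positions of `u`. -/
def inverseBWT {k N : ℕ} [NeZero N] (u : Word k N) (g : Equiv.Perm (Fin N)) : Word k N :=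
  fun j => u ((g⁻¹ ^ ((j : ℕ) + 1)) 0)

section
variable {k N : ℕ} [NeZero N]

theorem isCycleOn_inv {g : Equiv.Perm (Fin N)} (hc : ∀ x, g.SameCycle x 0) :
    g⁻¹.IsCycleOn (Finset.univ : Finset (Fin N)) := by
  refine ⟨by simp, fun x _ y _ => ?_⟩
  exact Equiv.Perm.sameCycle_inv.2 ((hc x).trans (hc y).symm)

theorem inv_pow_mod_apply {g : Equiv.Perm (Fin N)} (hc : ∀ x, g.SameCycle x 0) (m : ℕ)
    (x : Fin N) : (g⁻¹ ^ (m % N)) x = (g⁻¹ ^ m) x := by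
  have := (isCycleOn_inv hc).pow_apply_eq_pow_apply (Finset.mem_univ x) (m := m % N) (n := m)
  rw [Finset.card_univ, Fintype.card_fin] at this
  exact this.2 (Nat.mod_modEq m N)

theorem rotate_inverseBWT {u : Word k N} {g : Equiv.Perm (Fin N)} (hc : ∀ x, g.SameCycle x 0)
    (r : ℕ) (j : Fin N) :
    rotate (inverseBWT u g) r j = u ((g⁻¹ ^ ((j : ℕ) + 1)) ((g⁻¹ ^ r) 0)) := by
  rw [rotate, inverseBWT, pow_succ', Equiv.Perm.mul_apply]
  dsimp only
  rw [inv_pow_mod_apply hc, ← Equiv.Perm.mul_apply, ← Equiv.Perm.mul_apply, ← pow_succ',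
    ← pow_add]
  congr 3
  omega

theorem wordBWTMatrix_inverseBWT {u : Word k N} {g : Equiv.Perm (Fin N)}
    (hg : IsStandardPerm u g) (hc : ∀ x, g.SameCycle x 0) (i j : Fin N) :
    wordBWTMatrix (inverseBWT u g) i j = u ((g⁻¹ ^ ((j : ℕ) + 1)) i) := by
  let t : Fin N → Fin N := fun r => (g⁻¹ ^ (r : ℕ)) 0
  have ht : Function.Surjective t := by
    intro x
    obtain ⟨m, hm, hx⟩ := (isCycleOn_inv hc).exists_pow_eq (Finset.mem_univ 0) (Finset.mem_univ x)
    rw [Finset.card_univ, Fintype.card_fin] at hm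
    exact ⟨⟨m, hm⟩, hx⟩
  let T : Equiv.Perm (Fin N) := Equiv.ofBijective t ht.bijective_of_finite
  have hrow : ∀ i j, rotate (inverseBWT u g) (T.symm i) j = u ((g⁻¹ ^ ((j : ℕ) + 1)) i) := by
    intro i j
    rw [rotate_inverseBWT hc]
    exact congrArg (fun x => u ((g⁻¹ ^ ((j : ℕ) + 1)) x)) (T.apply_symm_apply i)
  have hmono : Monotone (rotations (inverseBWT u g) ∘ T.symm) := by
    refine fun a b hab => le_of_not_gt fun hlt => ?_
    obtain ⟨m, hm, hlt⟩ := hlt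
    have hm' : ∀ j : Fin N, j < m → u ((g⁻¹ ^ ((j : ℕ) + 1)) b) = u ((g⁻¹ ^ ((j : ℕ) + 1)) a) := by
      intro j hj
      rw [← hrow, ← hrow]
      exact hm j hj
    have hlt' : u ((g⁻¹ ^ ((m : ℕ) + 1)) b) < u ((g⁻¹ ^ ((m : ℕ) + 1)) a) := by
      rw [← hrow, ← hrow]
      exact hlt
    have hback : ∀ (l : ℕ) (x : Fin N), g ((g⁻¹ ^ (l + 1)) x) = (g⁻¹ ^ l) x := fun l x => by
      rw [pow_succ', Equiv.Perm.mul_apply]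
      exact g.apply_symm_apply _
    -- While the two rows agree, `g⁻¹` preserves the order of the positions, because equal letters
    -- are ranked from left to right.
    have hle : ∀ l : ℕ, l ≤ m → (g⁻¹ ^ l) a ≤ (g⁻¹ ^ l) b := by
      intro l
      induction l with
      | zero => intro _; simpa using hab
      | succ l ih =>
        intro hl
        have h1 := ih (by omega)
        have h2 := hm' ⟨l, by omega⟩ (Fin.lt_def.2 hl)
        rcases h1.lt_or_eq with h3 | h3
        · rw [← hback l a, ← hback l b] at h3
          rcases hg.lt_or_of_lt h3 with h4 | h4
          · exact absurd h2.symm h4.ne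
          · exact h4.2.le
        · rw [pow_succ', Equiv.Perm.mul_apply, Equiv.Perm.mul_apply, h3]
    have h1 := hle m le_rfl
    have h2 := hg _ _ (Or.inl hlt')
    rw [hback, hback] at h2
    exact absurd h1 (not_le.2 h2)
  have h := Tuple.comp_sort_eq_comp_iff_monotone.2 hmono
  rw [← hrow i j]
  exact (congrFun (congrArg ofLex (congrFun h i)) j).symm

theorem wordBWT_inverseBWT {u : Word k N} {g : Equiv.Perm (Fin N)}
    (hg : IsStandardPerm u g) (hc : ∀ x, g.SameCycle x 0) :
    wordBWT (inverseBWT u g) = u := by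
  funext i
  rw [wordBWT, wordBWTMatrix_inverseBWT hg hc]
  have : N - 1 + 1 = N := Nat.sub_add_cancel (Nat.pos_of_ne_zero (NeZero.ne N))
  dsimp only
  rw [this, ← inv_pow_mod_apply hc, Nat.mod_self, pow_zero, Equiv.Perm.one_apply]

/-- A nontrivial period of `w` would repeat every row, making rows 0 and 1 equal against `h01`. With
distinct rows, moving the last letter of a row to its front permutes the rows by the standard
permutation of the last column. -/
theorem exists_rotate_eq_inverseBWT {w : Word k N} {g : Equiv.Perm (Fin N)} (hN : 2 ≤ N)
    (hg : IsStandardPerm (wordBWT w) g)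
    (h01 : wordBWT w ⟨0, by omega⟩ ≠ wordBWT w ⟨1, by omega⟩) :
    (∀ x, g.SameCycle x 0) ∧ ∃ r : ℕ, rotate w r = inverseBWT (wordBWT w) g := by
  set u := wordBWT w
  set S : Equiv.Perm (Fin N) := Tuple.sort (rotations w) with hS
  let R : Fin N → Lex (Word k N) := fun i => rotations w (S i)
  have hR : Monotone R := Tuple.monotone_sort (rotations w)
  have hRapp : ∀ i j, ofLex (R i) j = w (j + S i) := fun _ _ => rfl
  have hlast : (⟨N - 1, by omega⟩ : Fin N) = -1 := by
    refine eq_neg_of_add_eq_zero_left (Fin.ext ?_)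
    have h1 : 1 % N = 1 := Nat.mod_eq_of_lt (by omega)
    simp only [Fin.val_add, Fin.val_one', h1, Nat.sub_add_cancel (show 1 ≤ N by omega),
      Nat.mod_self, Fin.val_zero]
  have hu : ∀ i, u i = w (-1 + S i) := by
    intro i
    rw [← hlast]
    rfl
  have hRinj : Function.Injective R := by
    intro x y hxy
    by_contra hne
    have hper : ∀ j, w (j + (S y - S x)) = w j := by
      intro j
      have := congrFun (congrArg ofLex hxy) (j - S x)
      rw [hRapp, hRapp, sub_add_cancel] at this
      rw [this]
      congr 1
      abel
    set c := S y - S x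
    have hc : c ≠ 0 := sub_ne_zero.2 fun h => hne (S.injective h).symm
    set z : Fin N := S.symm (S 0 + c)
    have hz : z ≠ 0 := by
      intro h
      have : S 0 + c = S 0 := by rw [← S.apply_symm_apply (S 0 + c)]; exact congrArg S h
      exact hc (add_eq_left.1 this)
    have hRz : R z = R 0 := by
      refine congrArg toLex (funext fun j => ?_)
      change w (j + S z) = w (j + S 0)
      rw [S.apply_symm_apply, ← add_assoc, hper]
    have h1 : R ⟨1, by omega⟩ = R 0 := by
      refine le_antisymm (hRz ▸ hR ?_) (hR (Fin.zero_le _))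
      rw [Fin.le_def]
      exact Nat.one_le_iff_ne_zero.2 fun h => hz (Fin.ext h)
    apply h01
    rw [hu, hu]
    exact (congrFun (congrArg ofLex h1) (-1)).symm
  have hRs : StrictMono R := hR.strictMono_of_injective hRinj
  let σ : Equiv.Perm (Fin N) := (S.trans (Equiv.addLeft (-1))).trans S.symm
  have hSσ : ∀ x, S (σ x) = -1 + S x := fun x => S.apply_symm_apply _
  have hσ0 : ∀ x, ofLex (R (σ x)) 0 = u x := by
    intro x
    rw [hRapp, hSσ, zero_add, hu]
  have hσs : ∀ x j, ofLex (R (σ x)) (j + 1) = ofLex (R x) j := by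
    intro x j
    rw [hRapp, hRapp, hSσ]
    congr 1
    abel
  have hσ : IsStandardPerm u σ := by
    rintro x y (h | ⟨h, hxy⟩)
    · refine hRs.lt_iff_lt.1 ⟨0, fun j hj => absurd hj (Fin.not_lt_zero j), ?_⟩
      change ofLex (R (σ x)) 0 < ofLex (R (σ y)) 0
      rwa [hσ0, hσ0]
    · obtain ⟨m, hm, hlt⟩ := hRs hxy
      change ∀ j < m, ofLex (R x) j = ofLex (R y) j at hm
      change ofLex (R x) m < ofLex (R y) m at hlt
      -- The last letters agree, so the first difference lies earlier and `m + 1` does not wrap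
      -- around to 0.
      have hmne : (m : ℕ) ≠ N - 1 := by
        intro hmN
        have : m = -1 := by rw [← hlast]; exact Fin.ext hmN
        rw [this, hRapp, hRapp, ← hu, ← hu] at hlt
        exact hlt.ne h
      have hval : ∀ j : Fin N, (j : ℕ) ≠ N - 1 → ((j + 1 : Fin N) : ℕ) = (j : ℕ) + 1 := by
        intro j hj
        have h1 : 1 % N = 1 := Nat.mod_eq_of_lt (by omega)
        rw [Fin.val_add, Fin.val_one', h1, Nat.mod_eq_of_lt (by omega)]
      refine hRs.lt_iff_lt.1 ⟨m + 1, fun j hj => ?_, ?_⟩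
      · change ofLex (R (σ x)) j = ofLex (R (σ y)) j
        rcases eq_or_ne j 0 with rfl | hj0
        · rw [hσ0, hσ0, h]
        · have hjlt : j - 1 < m := by
            have h2 := hval (j - 1)
            rw [sub_add_cancel] at h2
            have h3 : ((j - 1 : Fin N) : ℕ) ≠ N - 1 := by
              intro h4
              apply hj0
              have : j - 1 = -1 := by rw [← hlast]; exact Fin.ext h4
              simpa using this
            have h4 := h2 h3
            have hj' : (j : ℕ) < ((m + 1 : Fin N) : ℕ) := hj
            rw [hval m hmne] at hj'
            rw [Fin.lt_def]
            omega
          have := hm _ hjlt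
          rwa [← hσs x, ← hσs y, sub_add_cancel] at this
      · change ofLex (R (σ x)) (m + 1) < ofLex (R (σ y)) (m + 1)
        rwa [hσs, hσs]
  obtain rfl : σ = g := hg.unique hσ
  -- Through `S`, `σ⁻¹` is translation by 1 on ℤ/N: hence a single cycle, reading off `w` from `S
  -- 0`.
  have hpow : ∀ (m : ℕ) x, S ((σ⁻¹ ^ m) x) = Fin.ofNat N m + S x := by
    intro m
    induction m with
    | zero => intro x; simp
    | succ m ih =>
      intro x
      have h1 : S (σ⁻¹ ((σ⁻¹ ^ m) x)) = 1 + S ((σ⁻¹ ^ m) x) := by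
        have h2 : S ((σ⁻¹ ^ m) x) = -1 + S (σ⁻¹ ((σ⁻¹ ^ m) x)) := by
          rw [← hSσ]
          exact congrArg S (σ.apply_symm_apply _).symm
        rw [h2]
        abel
      rw [pow_succ', Equiv.Perm.mul_apply, h1, ih, ← add_assoc]
      congr 1
      ext
      simp [Fin.val_add, add_comm]
  constructor
  · intro x
    rw [← Equiv.Perm.sameCycle_inv]
    refine ⟨((S 0 - S x : Fin N) : ℕ), S.injective ?_⟩
    rw [zpow_natCast, hpow, Fin.ofNat_val_eq_self, sub_add_cancel]
  · refine ⟨S 0, funext fun j => ?_⟩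
    rw [inverseBWT, hu, hpow]
    change w (j + S 0) = _
    congr 1
    rw [← add_assoc]
    congr 1
    have : Fin.ofNat N ((j : ℕ) + 1) = j + 1 := by
      ext
      simp [Fin.val_add]
    rw [this]
    abel

end

end BWNecklace

namespace BWNecklace
open Matrix

/-! ### Generalized de Bruijn words as Eulerian circuits, and the final count. -/

/-- The positions of a word of length `p * n`, as pairs of a block and an index in it. -/
def blockEquiv (p n : ℕ) : Fin n × Fin p ≃ Fin (p * n) :=
  finProdFinEquiv.trans (finCongr (mul_comm n p))

/-- The ranks of the pairs of a block and a letter, ordered by the letter first. -/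
def rankEquiv (p n : ℕ) : Fin n × Fin p ≃ Fin (p * n) :=
  (Equiv.prodComm _ _).trans finProdFinEquiv

/-- The word whose blocks are the given permutations of the alphabet. -/
def permWord {p n : ℕ} (π : Fin n → Equiv.Perm (Fin p)) : Word p (p * n) :=
  fun x => π ((blockEquiv p n).symm x).1 ((blockEquiv p n).symm x).2

/-- The edges of the generalized de Bruijn graph on `n` vertices. -/
def deBruijnEdges (p n : ℕ) : Equiv.Perm (Fin n × Fin p) :=
  (rankEquiv p n).trans (blockEquiv p n).symm

/-- The standard permutation of `permWord π`. -/
def permWordPerm {p n : ℕ} (π : Fin n → Equiv.Perm (Fin p)) : Equiv.Perm (Fin (p * n)) :=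
  (blockEquiv p n).permCongr (transition (deBruijnEdges p n) π)

theorem permWord_blockEquiv {p n : ℕ} (π : Fin n → Equiv.Perm (Fin p)) (b : Fin n) (i : Fin p) :
    permWord π (blockEquiv p n (b, i)) = π b i := by
  simp [permWord]

theorem blockEquiv_val {p n : ℕ} (b : Fin n) (i : Fin p) :
    (blockEquiv p n (b, i) : ℕ) = i + p * b := rfl

theorem permWordPerm_blockEquiv_val {p n : ℕ} (π : Fin n → Equiv.Perm (Fin p)) (b : Fin n)
    (i : Fin p) : (permWordPerm π (blockEquiv p n (b, i)) : ℕ) = b + n * (π b i : ℕ) := by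
  simp only [permWordPerm, Equiv.permCongr_apply, Equiv.symm_apply_apply, transition_apply,
    deBruijnEdges, Equiv.trans_apply, Equiv.apply_symm_apply]
  rfl

/-- Each letter occurs once per block, so letter `a` in block `b` has rank `b + n * a`. -/
theorem isStandardPerm_permWord {p n : ℕ} (π : Fin n → Equiv.Perm (Fin p)) :
    IsStandardPerm (permWord π) (permWordPerm π) := by
  intro x y
  obtain ⟨⟨b, i⟩, rfl⟩ := (blockEquiv p n).surjective x
  obtain ⟨⟨c, j⟩, rfl⟩ := (blockEquiv p n).surjective y
  rw [permWord_blockEquiv, permWord_blockEquiv, Fin.lt_def (a := permWordPerm π _),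
    permWordPerm_blockEquiv_val, permWordPerm_blockEquiv_val]
  rintro (h | ⟨h, hlt⟩)
  · have h1 : n * (π b i : ℕ) + n ≤ n * (π c j : ℕ) := by
      rw [← Nat.mul_succ]
      exact Nat.mul_le_mul_left n h
    omega
  · rw [Fin.lt_def, blockEquiv_val, blockEquiv_val] at hlt
    rw [h]
    refine Nat.add_lt_add_right ?_ _
    by_contra hcb
    rcases (not_lt.1 hcb).lt_or_eq with h1 | h1
    · have h2 : p * (c : ℕ) + p ≤ p * (b : ℕ) := by
        rw [← Nat.mul_succ]
        exact Nat.mul_le_mul_left p h1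
      omega
    · obtain rfl : c = b := Fin.ext h1
      obtain rfl := (π c).injective h
      exact lt_irrefl _ hlt

theorem block_index_eq {p n : ℕ} (b : Fin n) (i : Fin p) :
    (⟨p * (b : ℕ) + (i : ℕ), block_index_lt b i⟩ : Fin (p * n)) = blockEquiv p n (b, i) :=
  Fin.ext (add_comm _ _)

theorem isAlphabetPermutationPower_iff {p n : ℕ} (u : Word p (p * n)) :
    IsAlphabetPermutationPower u ↔ ∃ π, permWord π = u := by
  simp only [IsAlphabetPermutationPower, block_index_eq]
  constructor
  · intro h
    have hb : ∀ b : Fin n, Function.Bijective fun i : Fin p => u (blockEquiv p n (b, i)) :=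
      fun b => (Function.bijective_iff_existsUnique _).2 (h b)
    refine ⟨fun b => Equiv.ofBijective _ (hb b), funext fun x => ?_⟩
    obtain ⟨⟨b, i⟩, rfl⟩ := (blockEquiv p n).surjective x
    rw [permWord_blockEquiv]
    rfl
  · rintro ⟨π, rfl⟩ b
    simp only [permWord_blockEquiv]
    exact (Function.bijective_iff_existsUnique _).1 (π b).bijective

theorem permWord_injective {p n : ℕ} :
    Function.Injective (permWord : (Fin n → Equiv.Perm (Fin p)) → Word p (p * n)) := by
  intro π ρ h
  funext b
  ext i
  rw [← permWord_blockEquiv π, h, permWord_blockEquiv]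

theorem sameCycle_permWordPerm_iff {p n : ℕ} (π : Fin n → Equiv.Perm (Fin p))
    (x y : Fin n × Fin p) :
    (permWordPerm π).SameCycle (blockEquiv p n x) (blockEquiv p n y) ↔
      (transition (deBruijnEdges p n) π).SameCycle x y := by
  refine exists_congr fun i => ?_
  have : permWordPerm π ^ i =
      (blockEquiv p n).permCongr (transition (deBruijnEdges p n) π ^ i) :=
    (map_zpow (blockEquiv p n).permCongrHom _ i).symm
  rw [this, Equiv.permCongr_apply, Equiv.symm_apply_apply, EmbeddingLike.apply_eq_iff_eq]

/-- Generalized de Bruijn words correspond to the Eulerian circuits of the generalized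
de Bruijn graph. -/
theorem DBW_eq_card_transition {p n : ℕ} [NeZero n] (hp : 2 ≤ p) :
    ∃ e₀ : Fin n × Fin p, DBW p n = Nat.card {π : Fin n → Equiv.Perm (Fin p) //
      ∀ e, (transition (deBruijnEdges p n) π).SameCycle e e₀} := by
  have hn := Nat.pos_of_ne_zero (NeZero.ne n)
  have : NeZero (p * n) := ⟨(Nat.mul_pos (by omega) hn).ne'⟩
  refine ⟨(blockEquiv p n).symm 0, ?_⟩
  have hiff : ∀ π : Fin n → Equiv.Perm (Fin p),
      (∀ e, (transition (deBruijnEdges p n) π).SameCycle e ((blockEquiv p n).symm 0)) ↔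
        ∀ x, (permWordPerm π).SameCycle x 0 := by
    intro π
    rw [← (blockEquiv p n).forall_congr_right]
    refine forall_congr' fun e => ?_
    rw [← sameCycle_permWordPerm_iff, Equiv.apply_symm_apply]
  have hbwt : ∀ π : Fin n → Equiv.Perm (Fin p), (∀ x, (permWordPerm π).SameCycle x 0) →
      wordBWT (inverseBWT (permWord π) (permWordPerm π)) = permWord π :=
    fun π h => wordBWT_inverseBWT (isStandardPerm_permWord π) h
  symm
  refine Nat.card_congr (Equiv.ofBijective (fun π => ⟨Quotient.mk (conjugate p (p * n))
    (inverseBWT (permWord π.1) (permWordPerm π.1)), ?_⟩) ⟨fun π ρ h => ?_, fun ⟨x, hx⟩ => ?_⟩)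
  · change IsAlphabetPermutationPower (wordBWT _)
    rw [hbwt _ ((hiff _).1 π.2), isAlphabetPermutationPower_iff]
    exact ⟨_, rfl⟩
  · have h1 := congrArg (fun x => Necklace.bwt x.1) h
    change wordBWT _ = wordBWT _ at h1
    rw [hbwt _ ((hiff _).1 π.2), hbwt _ ((hiff _).1 ρ.2)] at h1
    exact Subtype.ext (permWord_injective h1)
  · induction x using Quotient.inductionOn with
    | h w =>
    change IsAlphabetPermutationPower (wordBWT w) at hx
    obtain ⟨π, hπ⟩ := (isAlphabetPermutationPower_iff _).1 hx
    have hN : 2 ≤ p * n := hp.trans (Nat.le_mul_of_pos_right p hn)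
    have hb0 : (⟨0, by omega⟩ : Fin (p * n)) = blockEquiv p n (0, ⟨0, by omega⟩) := by
      ext; simp [blockEquiv_val]
    have hb1 : (⟨1, by omega⟩ : Fin (p * n)) = blockEquiv p n (0, ⟨1, by omega⟩) := by
      ext; simp [blockEquiv_val]
    -- The first two letters lie in one block, as `2 ≤ p`, and so differ.
    obtain ⟨hc, r, hr⟩ := exists_rotate_eq_inverseBWT (w := w) (g := permWordPerm π) hN
      (hπ ▸ isStandardPerm_permWord π) (by
        rw [← hπ, hb0, hb1, permWord_blockEquiv, permWord_blockEquiv]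
        exact fun h => absurd ((π 0).injective h) (by simp))
    refine ⟨⟨π, (hiff π).2 hc⟩, Subtype.ext ?_⟩
    change Quotient.mk (conjugate p (p * n)) (inverseBWT (permWord π) (permWordPerm π)) = _
    rw [hπ, ← hr]
    exact (Quotient.sound (⟨r, rfl⟩ : (conjugate p (p * n)).r w (rotate w r))).symm

theorem sameCycle_addRight_one {n : ℕ} [NeZero n] (v w : Fin n) :
    (Equiv.addRight (1 : Fin n)).SameCycle v w := by
  refine ⟨((w - v : Fin n) : ℕ), ?_⟩
  have h : ∀ k : ℕ, (Equiv.addRight (1 : Fin n) ^ k) v = v + Fin.ofNat n k := by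
    intro k
    induction k with
    | zero => simp
    | succ k ih =>
      rw [pow_succ', Equiv.Perm.mul_apply, ih, Equiv.coe_addRight]
      dsimp only
      rw [add_assoc]
      congr 1
      ext
      simp [Fin.val_add]
  rw [zpow_natCast, h, Fin.ofNat_val_eq_self, add_sub_cancel]

theorem deBruijnEdges_symm_fst {p n : ℕ} (w : Fin n) (i : Fin p) :
    (((deBruijnEdges p n).symm (w, i)).1 : ℕ) = (p * w + i) % n := by
  change ((i : ℕ) + p * w) % n = _
  rw [add_comm]

theorem DBW_mul_eq {p n : ℕ} (hp : p.Prime) (hn : n ≠ 0) :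
    (DBW p n : ℚ) * (((p : ℚ) - 1) * n) = ((p - 1).factorial : ℚ) ^ n * Phi p n := by
  have : NeZero n := ⟨hn⟩
  have : Nonempty (Fin p) := ⟨⟨0, hp.pos⟩⟩
  have : Nonempty (Fin n) := ⟨0⟩
  have hp0 : (p : ℚ) ≠ 0 := by exact_mod_cast hp.ne_zero
  have hp1 : (1 : ℚ) < p := by exact_mod_cast hp.one_lt
  have hn0 : (0 : ℚ) < n := by exact_mod_cast Nat.pos_of_ne_zero hn
  obtain ⟨e₀, h1⟩ := DBW_eq_card_transition (n := n) hp.two_le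
  have h2 := card_transition_cycle (deBruijnEdges p n) e₀
  have h3 := det_average (deBruijnEdges p n) e₀
  -- Here `f i w = p w + i` modulo `n` and `s` adds 1, so `f p w = p (w + 1)`.
  have h4 := det_sub_funMatrix (p := p) (Equiv.addRight (1 : Fin n)) sameCycle_addRight_one
    (deBruijnEdges p n) (fun i w => ⟨(p * w + i) % n, Nat.mod_lt _ w.pos⟩)
    (fun i w => Fin.ext (by simp [Fin.val_add, add_assoc]))
    (fun w => Fin.ext (by
      rw [Equiv.coe_addRight, Fin.val_add, Fin.val_one']
      change (p * w + p) % n = (p * ((w + 1 % n) % n) + 0) % n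
      rw [add_zero, Nat.add_mod_mod, Nat.mul_mod_mod, mul_add, mul_one]))
    (fun w i => Fin.ext (deBruijnEdges_symm_fst w i)) ((deBruijnEdges p n).symm e₀).1 e₀.1
  rw [← h1] at h2
  simp only [Fintype.card_fin] at h2 h3 h4
  rw [← h3] at h4
  set c := det (1 - Matrix.of fun e f : Fin n × Fin p =>
    if e ≠ e₀ ∧ ((deBruijnEdges p n).symm f).1 = e.1 then (p : ℚ)⁻¹ else 0)
  have hcast : det ((p : ℚ) • (1 : Matrix (Fin n) (Fin n) ℚ) - funMatrix ℚ
      (fun w : Fin n => (⟨(p * w + 0) % n, Nat.mod_lt _ w.pos⟩ : Fin n))) =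
      (det ((p : ℤ) • (1 : Matrix (Fin n) (Fin n) ℤ) - funMatrix ℤ (mulMod p n)) : ℤ) := by
    rw [← eq_intCast (Int.castRingHom ℚ), RingHom.map_det]
    congr 1
    ext u w
    rw [smul_one_sub_funMatrix_apply, RingHom.mapMatrix_apply, map_apply,
      smul_one_sub_funMatrix_apply]
    have : (⟨(p * w + 0) % n, Nat.mod_lt _ w.pos⟩ : Fin n) = mulMod p n w := rfl
    rw [this]
    split_ifs <;> simp
  -- A positive multiple of `c` is a cardinality; this settles the sign lost in `natAbs`.
  have hc : 0 ≤ c := by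
    have h5 : (0 : ℚ) ≤ (p.factorial : ℚ) ^ n * c := h2 ▸ Nat.cast_nonneg _
    have h6 : (0 : ℚ) < (p.factorial : ℚ) ^ n := by positivity
    exact nonneg_of_mul_nonneg_right h5 h6
  have hPhi : (Phi p n : ℚ) = ((p : ℚ) - 1) * n * ((p : ℚ) ^ n * c) := by
    rw [Phi_eq_natAbs_det hp hn, Nat.cast_natAbs, Int.cast_abs, ← hcast, h4]
    refine abs_of_nonneg (mul_nonneg (mul_nonneg (by linarith) hn0.le) (mul_nonneg ?_ hc))
    positivity
  rw [h2, hPhi, ← Nat.mul_factorial_pred hp.ne_zero]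
  push_cast
  ring

end BWNecklace

theorem mainTheorem5 (p : ℕ) (hp : p.Prime) (n : ℕ) (hn : 2 ≤ n) :
    (BWNecklace.DBW p n : ℚ) =
        (((p - 1).factorial : ℚ) ^ n / ((p : ℚ) - 1)) * ((BWNecklace.Phi p n : ℚ) / (n : ℚ)) ∧
      (BWNecklace.DBW p n : ℚ) =
        (((p - 1).factorial : ℚ) ^ n / ((p : ℚ) - 1)) * (BWNecklace.InvNeck p n : ℚ) ∧
      (BWNecklace.Phi p n : ℚ) / (n : ℚ) = (BWNecklace.InvNeck p n : ℚ) := by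
  have hn0 : n ≠ 0 := by omega
  have hp1 : (p : ℚ) - 1 ≠ 0 := sub_ne_zero.2 (by exact_mod_cast hp.one_lt.ne')
  have hnq : (n : ℚ) ≠ 0 := by exact_mod_cast hn0
  have h1 := BWNecklace.DBW_mul_eq hp hn0
  have h2 : (BWNecklace.Phi p n : ℚ) / n = BWNecklace.InvNeck p n := by
    rw [div_eq_iff hnq]
    exact_mod_cast BWNecklace.Phi_eq_InvNeck_mul hp hn0
  have h3 : (BWNecklace.DBW p n : ℚ) =
      (((p - 1).factorial : ℚ) ^ n / ((p : ℚ) - 1)) * ((BWNecklace.Phi p n : ℚ) / (n : ℚ)) := by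
    field_simp
    linear_combination h1
  exact ⟨h3, h2 ▸ h3, h2⟩
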